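/- **Setting.** An $n$-qubit system in the state $\rho_S$ undergoes $K$ collisions. The $j$-th collision, of duration $\Delta t>0$, is with a sub-environment of $e_j$ qubits in the state $\rho_{E_j}$, and has total Hamiltonian $H_j=\sum_{i=1}^{L_j}h_{i,j}P_{i,j}$ with $L_j\ge 1$, $h_{i,j}>0$ and $P_{i,j}\in\pm\{I,\sigma^x,\sigma^y,\sigma^z\}^{\otimes(n+e_j)}$. Put $\beta_j=\sum_i h_{i,j}$, $p_{i,j}=h_{i,j}/\beta_j$, $\beta=\max_j\beta_j$, $U_j=e^{-i\Delta t H_j}$, $\Phi_j[\rho]=\mathrm{Tr}_{E_j}[U_j(\rho\otimes\rho_{E_j})U_j^\dagger]$ and $\mathcal M_K=\Phi_K\circ\dots\circ\Phi_1$. Each $\rho_{E_j}$ is prepared from $|0\cdots0\rangle$ by a unitary circuit of depth $\tau_{\rho_{E_j}}$ consisting of layers of disjoint one- and two-qubit gates (possibly with work qubits that are discarded); $\tau_{\rho_E}=\max_j\tau_{\rho_{E_j}}$. Let $O\neq0$ be an observable (a Hermitian operator) on the system, $\|\cdot\|$ the spectral norm. **Algorithm 1.** Input: for each $j$ a linear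 combination of unitaries (LCU) $\widetilde U_j=\sum_k\alpha_{jk}W_{jk}$, $\alpha_{jk}\ge0$, with weight $\alpha^{(j)}=\sum_k\alpha_{jk}$, each unitary $W_{jk}$ a product of Pauli strings (with phases $i^c$) and Pauli rotations $e^{-i\theta P}$. One run: start with ancilla $|+\rangle$ and system $\rho_S$; for $j=1,\dots,K$, initialise the environment register in $\rho_{E_j}$, draw independently $X_j,Y_j$ from $\{W_{jk},\alpha_{jk}/\alpha^{(j)}\}_k$, apply $X_j$ controlled on the ancilla being $|1\rangle$ and $Y_j$ controlled on the ancilla being $|0\rangle$, and trace out the environment register; finally measure $\sigma^x\otimes O$ on ancilla and system. After $T$ independent runs with outcomes $\mu_1,\dots,\mu_T$, output $\mu=\frac{\zeta^2}{T}\sum_i\mu_i$, where $\zeta=\prod_j\alpha^{(j)}$. The depth of a run counts every controlled Pauli string and every controlled Pauli rotation as one step, plus the depths of the $K$ preparations. **Truncated Taylor LCU.** For integers $r\ge1$, $q\ge0$, it is the expansion into products of the $r$-th power of $$\sum_{0\le k\le q,\;k\text{ even}}\ \sum_{\ell_1,\dots,\ell_k,m}\frac{x^k}{k!}\sqrt{1+\Big(\frac{x}{k+1}\Big)^2}\;p_{\ell_1,j}\cdots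 p_{\ell_k,j}\,p_{m,j}\;(-iP_{\ell_1,j})\cdots(-iP_{\ell_k,j})\,e^{-i\theta_kP_{m,j}},$$ where $x=\beta_j\Delta t/r$ and $\theta_k=\arccos\big((1+(x/(k+1))^2)^{-1/2}\big)$. **Theorem.** There is a universal constant $C>0$ such that the following holds for all such data and all $\varepsilon,\delta\in(0,1)$. Put $\varepsilon'=\varepsilon/(6K\|O\|)$. 1. If $\varepsilon\le\|O\|$, then for all input LCUs with $\|U_j-\widetilde U_j\|\le\varepsilon'$ for every $j$, and all integers $T\ge 8\|O\|^2\ln(2/\delta)\,\zeta^4/\varepsilon^2$, Algorithm 1 outputs $\mu$ with $|\mu-\mathrm{Tr}[O\,\mathcal M_K[\rho_S]]|\le\varepsilon$ with probability at least $1-\delta$. 2. There are integers $r\ge 1$, $q$, $T$ with $r\le C\max\{1,\beta^2\Delta t^2K\}$ and $$T\le C\max\Big\{1,\frac{\|O\|^2\log\max\{2,1/\delta\}}{\varepsilon^2}\Big\}$$ such that the truncated Taylor LCUs $\widetilde U_j$ with parameters $r,q$ satisfy $\|U_j-\widetilde U_j\|\le\varepsilon'$ for every $j$ and $\zeta\le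 C$; Algorithm 1 with these LCUs and $T$ runs outputs $\mu$ with $|\mu-\mathrm{Tr}[O\,\mathcal M_K[\rho_S]]|\le\varepsilon$ with probability at least $1-\delta$; and every run, whatever is sampled, has circuit depth at most $$C\left(K\max\{1,\beta^2\Delta t^2K\}\,\frac{\log y}{\log\log y}+K\tau_{\rho_E}\right),\qquad y=\max\Big\{16,\frac{\beta K\|O\|\Delta t}{\varepsilon}\Big\}.$$ In particular, as soon as $\beta^2\Delta t^2K\ge1$, $\beta K\|O\|\Delta t/\varepsilon\ge16$, $\delta\le1/2$ and $\varepsilon\le\|O\|$, one has $T=\mathcal O(\|O\|^2\log(1/\delta)/\varepsilon^2)$ and depth $\mathcal O\big(\beta^2K^2\Delta t^2\frac{\log(\beta K\|O\|\Delta t/\varepsilon)}{\log\log(\beta K\|O\|\Delta t/\varepsilon)}+K\tau_{\rho_E}\big)$ with universal constants. -/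

import Mathlib

open scoped Matrix Kronecker ComplexOrder Matrix.Norms.L2Operator

noncomputable section

namespace Collision

/-! ### Qubit registers, states, partial traces -/

/-- Operators on a register whose qubits are labelled by `ι`, in the computational basis
`ι → Fin 2`. -/
abbrev QOp (ι : Type) : Type := Matrix (ι → Fin 2) (ι → Fin 2) ℂ

/-- Operators on the joint space of an `n`-qubit system and an `e`-qubit sub-environment. -/
abbrev SEOp (n e : ℕ) : Type :=
  Matrix ((Fin n → Fin 2) × (Fin e → Fin 2)) ((Fin n → Fin 2) × (Fin e → Fin 2)) ℂ

/-- Operators on the joint space of the ancilla qubit and the `n`-qubit system. -/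
abbrev ASOp (n : ℕ) : Type := Matrix (Fin 2 × (Fin n → Fin 2)) (Fin 2 × (Fin n → Fin 2)) ℂ

/-- Density operators. -/
def IsDensity {s : Type} [Fintype s] (ρ : Matrix s s ℂ) : Prop :=
  ρ.PosSemidef ∧ ρ.trace = 1

/-- The partial trace over the second tensor factor. -/
def ptrace {s t : Type} [Fintype t] (M : Matrix (s × t) (s × t) ℂ) : Matrix s s ℂ :=
  Matrix.of fun x y => ∑ z, M (x, z) (y, z)

/-! ### Pauli strings -/

/-- The labels of the single-qubit Pauli operators. -/
inductive Pauli : Type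
  | I | X | Y | Z

/-- The single-qubit Pauli matrices. -/
def Pauli.mat : Pauli → Matrix (Fin 2) (Fin 2) ℂ
  | Pauli.I => !![1, 0; 0, 1]
  | Pauli.X => !![0, 1; 1, 0]
  | Pauli.Y => !![0, -Complex.I; Complex.I, 0]
  | Pauli.Z => !![1, 0; 0, -1]

/-- The tensor product of the Pauli matrices `P i` over the qubits `i` of a register. -/
def pauliTensor {ι : Type} [Fintype ι] (P : ι → Pauli) : QOp ι :=
  Matrix.of fun x y => ∏ i, (P i).mat (x i) (y i)

/-- Elements of `± {I, σˣ, σʸ, σᶻ}^{⊗ (n + e)}`, on system and sub-environment. -/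
structure PauliString (n e : ℕ) : Type where
  sign : ℤˣ
  sys : Fin n → Pauli
  env : Fin e → Pauli

/-- The operator denoted by a signed Pauli string. -/
def PauliString.mat {n e : ℕ} (P : PauliString n e) : SEOp n e :=
  ((P.sign : ℤ) : ℂ) • (pauliTensor P.sys ⊗ₖ pauliTensor P.env)

/-! ### The collision model -/

/-- `K` collisions of an `n`-qubit system with sub-environments: the `j`-th sub-environment has
`e j` qubits, the total Hamiltonian of the `j`-th collision is `∑ i, h j i • P j i` with `L j`
terms and positive coefficients, and every collision lasts for the time `Δt`. -/
structure Model (n K : ℕ) : Type where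
  e : Fin K → ℕ
  L : Fin K → ℕ
  L_pos : ∀ j, 0 < L j
  h : ∀ j, Fin (L j) → ℝ
  h_pos : ∀ j i, 0 < h j i
  P : ∀ j, Fin (L j) → PauliString n (e j)
  Δt : ℝ
  Δt_pos : 0 < Δt

namespace Model

variable {n K : ℕ} (M : Model n K)

/-- The total Hamiltonian `H_j` of the `j`-th collision. -/
def ham (j : Fin K) : SEOp n (M.e j) := ∑ i, (M.h j i : ℂ) • (M.P j i).mat

/-- The weight `β_j = ∑ i, h_{i,j}`. -/
def weight (j : Fin K) : ℝ := ∑ i, M.h j i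

/-- `β = max_j β_j`. -/
def maxWeight : ℝ := ⨆ j, M.weight j

/-- The collision unitary `U_j = exp (-i Δt H_j)`. -/
def unitary (j : Fin K) : SEOp n (M.e j) :=
  NormedSpace.exp ((-(Complex.I * (M.Δt : ℂ))) • M.ham j)

/-- The Markovian `K`-collision map `Φ_K ∘ ⋯ ∘ Φ_1`, where
`Φ_j[ρ] = Tr_{E_j} [U_j (ρ ⊗ ρ_{E_j}) U_j†]`. -/
def collisionMap (ρE : ∀ j, QOp (Fin (M.e j))) (ρ : QOp (Fin n)) : QOp (Fin n) :=
  Fin.foldl K (fun σ j => ptrace (M.unitary j * (σ ⊗ₖ ρE j) * (M.unitary j)ᴴ)) ρ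

end Model

/-! ### Gates, words of gates, and LCU decompositions -/

/-- The elementary operations from which the unitaries of an LCU decomposition are composed:
Pauli strings with a phase `i ^ c`, and Pauli rotations `exp (-i θ P)`. -/
inductive PauliGate (n e : ℕ) : Type
  | string (c : Fin 4) (P : PauliString n e)
  | rotation (θ : ℝ) (P : PauliString n e)

/-- The unitary of a gate; as `P ^ 2 = 1`, `exp (-i θ P) = cos θ - i sin θ P`. -/
def PauliGate.mat {n e : ℕ} : PauliGate n e → SEOp n e
  | PauliGate.string c P => Complex.I ^ (c : ℕ) • P.mat
  | PauliGate.rotation θ P => (Real.cos θ : ℂ) • 1 - (Complex.I * (Real.sin θ : ℂ)) • P.mat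

/-- The unitary of a word of gates (operator order: the last gate acts first). Since rotations
about the identity string are global phases, every unitary is the unitary of some word. -/
def wordMat {n e : ℕ} (w : List (PauliGate n e)) : SEOp n e := (w.map PauliGate.mat).prod

/-- A linear combination of unitaries `∑ k, α_k W_k`, with coefficients `α_k ≥ 0` (phases belong
to the `W_k`) and each `W_k` given as a word of gates. -/
structure LCU (n e : ℕ) : Type 1 where
  Idx : Type
  fintypeIdx : Fintype Idx
  coeff : Idx → ℝ
  coeff_nonneg : ∀ k, 0 ≤ coeff k
  word : Idx → List (PauliGate n e)

attribute [instance] LCU.fintypeIdx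

namespace LCU

variable {n e : ℕ} (D : LCU n e)

/-- The operator `∑ k, α_k W_k`. -/
def op : SEOp n e := ∑ k, (D.coeff k : ℂ) • wordMat (D.word k)

/-- The total weight `∑ k, |α_k|`. -/
def weight : ℝ := ∑ k, D.coeff k

/-- The probability of `W_k` in the sampling ensemble. -/
def prob (k : D.Idx) : ℝ := D.coeff k / D.weight

end LCU

/-! ### The truncated Taylor series LCU -/

namespace Model

variable {n K : ℕ} (M : Model n K)

/-- Index set of one of the `r` segments: `⟨t, ℓ, m⟩` stands for the even order `k = 2 t ≤ q`,
the indices `ℓ_1, …, ℓ_k` of Pauli strings, and the index `m` of the Pauli rotation. -/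
abbrev SegIdx (j : Fin K) (q : ℕ) : Type :=
  Σ t : Fin (q / 2 + 1), (Fin (2 * (t : ℕ)) → Fin (M.L j)) × Fin (M.L j)

/-- `x / (k + 1)` where `x = β_j Δt / r` is the length of a segment. -/
def segAngle (j : Fin K) (r k : ℕ) : ℝ := M.weight j * M.Δt / r / (k + 1)

/-- The coefficient
`x ^ k / k! * √(1 + (x / (k + 1)) ^ 2) * p_{ℓ_1} ⋯ p_{ℓ_k} * p_m`, with `p_ℓ = h_ℓ / β_j`. -/
def segCoeff (j : Fin K) (r q : ℕ) (a : M.SegIdx j q) : ℝ :=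
  (M.weight j * M.Δt / r) ^ (2 * (a.1 : ℕ)) / (Nat.factorial (2 * (a.1 : ℕ)) : ℝ)
    * Real.sqrt (1 + M.segAngle j r (2 * (a.1 : ℕ)) ^ 2)
    * (∏ i, M.h j (a.2.1 i) / M.weight j) * (M.h j a.2.2 / M.weight j)

/-- The word `(-i P_{ℓ_1}) ⋯ (-i P_{ℓ_k}) exp (-i θ P_m)`, where
`cos θ = (1 + (x / (k + 1)) ^ 2) ^ (-1/2)`. -/
def segWord (j : Fin K) (r q : ℕ) (a : M.SegIdx j q) : List (PauliGate n (M.e j)) :=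
  (List.ofFn fun i => PauliGate.string 3 (M.P j (a.2.1 i)))
    ++ [PauliGate.rotation (Real.arccos (Real.sqrt (1 + M.segAngle j r (2 * (a.1 : ℕ)) ^ 2))⁻¹)
          (M.P j a.2.2)]

/-- The LCU of `exp (-i Δt H_j)` with `r` segments, each truncated at order `q`:
the `r`-th power of the LCU of one segment. -/
def taylorLCU (r q : ℕ) (j : Fin K) : LCU n (M.e j) where
  Idx := Fin r → M.SegIdx j q
  fintypeIdx := inferInstance
  coeff a := ∏ s, M.segCoeff j r q (a s)
  coeff_nonneg a := by
    have hw : 0 ≤ M.weight j := Finset.sum_nonneg fun i _ => (M.h_pos j i).le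
    refine Finset.prod_nonneg fun s _ => ?_
    unfold segCoeff
    have h1 : 0 ≤ M.weight j * M.Δt / r :=
      div_nonneg (mul_nonneg hw M.Δt_pos.le) (Nat.cast_nonneg r)
    have h2 : 0 ≤ ∏ i, M.h j ((a s).2.1 i) / M.weight j :=
      Finset.prod_nonneg fun i _ => div_nonneg (M.h_pos j _).le hw
    have h3 : 0 ≤ M.h j (a s).2.2 / M.weight j := div_nonneg (M.h_pos j _).le hw
    positivity
  word a := (List.ofFn fun s => M.segWord j r q (a s)).flatten

end Model

/-! ### Circuits preparing the sub-environments -/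

/-- A gate acting on at most two qubits of a register. -/
structure LocalGate (ι : Type) [DecidableEq ι] : Type where
  supp : Finset ι
  card_le : supp.card ≤ 2
  mat : Matrix.unitaryGroup (supp → Fin 2) ℂ

/-- The operator of a local gate on the whole register. -/
def LocalGate.toOp {ι : Type} [Fintype ι] [DecidableEq ι] (g : LocalGate ι) : QOp ι :=
  Matrix.of fun x y =>
    if ∀ i, i ∉ g.supp → x i = y i then
      (g.mat : Matrix (g.supp → Fin 2) (g.supp → Fin 2) ℂ) (fun i => x i) (fun i => y i)
    else 0

/-- A layer of a circuit: gates on pairwise disjoint sets of qubits. -/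
structure Layer (ι : Type) [DecidableEq ι] : Type where
  gates : List (LocalGate ι)
  disjoint : gates.Pairwise fun g g' => Disjoint g.supp g'.supp

/-- The operator of a layer. -/
def Layer.toOp {ι : Type} [Fintype ι] [DecidableEq ι] (l : Layer ι) : QOp ι :=
  (l.gates.map LocalGate.toOp).prod

/-- A unitary circuit preparing a state of an `e`-qubit register, possibly mixed, with the help of
`work` further qubits that are discarded. All qubits start in `|0⟩`. -/
structure PrepCircuit (e : ℕ) : Type where
  work : ℕ
  layers : List (Layer (Fin e ⊕ Fin work))

namespace PrepCircuit

variable {e : ℕ} (V : PrepCircuit e)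

/-- The circuit depth: the number of layers. -/
def depth : ℕ := V.layers.length

/-- The unitary of the circuit (operator order: the last layer acts first). -/
def toOp : QOp (Fin e ⊕ Fin V.work) := (V.layers.map Layer.toOp).prod

/-- The prepared state: the reduced state of `V |0⋯0⟩`. -/
def state : QOp (Fin e) :=
  Matrix.of fun x y =>
    ∑ z, V.toOp (Sum.elim x z) (fun _ => 0) * star (V.toOp (Sum.elim y z) (fun _ => 0))

end PrepCircuit

/-! ### The algorithm -/

/-- The gate `G` controlled on the ancilla being in the state `|b⟩`:
`|b⟩⟨b| ⊗ G + (1 - |b⟩⟨b|) ⊗ 1`, written on (ancilla ⊗ system) ⊗ sub-environment.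
It is a controlled gate for `b = 1` and an anti-controlled gate for `b = 0`. -/
def ctrlMat {n e : ℕ} (b : Fin 2) (G : SEOp n e) :
    Matrix ((Fin 2 × (Fin n → Fin 2)) × (Fin e → Fin 2))
      ((Fin 2 × (Fin n → Fin 2)) × (Fin e → Fin 2)) ℂ :=
  Matrix.submatrix
    (Matrix.single b b (1 : ℂ) ⊗ₖ G
      + (1 - Matrix.single b b (1 : ℂ)) ⊗ₖ (1 : SEOp n e))
    (Equiv.prodAssoc _ _ _) (Equiv.prodAssoc _ _ _)

/-- The gate sequence of one collision (operator order): the gates of `X` controlled on the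
ancilla, followed by the gates of `Y` anti-controlled on the ancilla. -/
def collisionGates {n e : ℕ} (X Y : List (PauliGate n e)) : List (Fin 2 × PauliGate n e) :=
  Y.map (fun g => (0, g)) ++ X.map (fun g => (1, g))

/-- The unitary `Y^(a) X^(c)` of the gate sequence of one collision. -/
def collisionOp {n e : ℕ} (X Y : List (PauliGate n e)) :
    Matrix ((Fin 2 × (Fin n → Fin 2)) × (Fin e → Fin 2))
      ((Fin 2 × (Fin n → Fin 2)) × (Fin e → Fin 2)) ℂ :=
  ((collisionGates X Y).map fun g => ctrlMat g.1 g.2.mat).prod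

/-- The state `|+⟩⟨+|` of the ancilla. -/
def plusState : Matrix (Fin 2) (Fin 2) ℂ := Matrix.of fun _ _ => 1 / 2

/-- The joint state of ancilla and system at the end of one run, when the words `X j` and `Y j`
have been sampled: for `j = 1, …, K`, the environment register is initialised in `ρ_{E_j}`, the
gate sequence is applied, and the environment register is traced out. -/
def finalState {n K : ℕ} {e : Fin K → ℕ} (ρS : QOp (Fin n)) (ρE : ∀ j, QOp (Fin (e j)))
    (X Y : ∀ j, List (PauliGate n (e j))) : ASOp n :=
  Fin.foldl K
    (fun σ j => ptrace (collisionOp (X j) (Y j) * (σ ⊗ₖ ρE j) * (collisionOp (X j) (Y j))ᴴ))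
    (plusState ⊗ₖ ρS)

/-- The circuit depth of one run. The gates of a collision all involve the ancilla, so that each
of them takes one time step; the preparations of the sub-environments, which reuse a single
register, are added. -/
def runDepth {n K : ℕ} {e : Fin K → ℕ} (V : ∀ j, PrepCircuit (e j))
    (X Y : ∀ j, List (PauliGate n (e j))) : ℕ :=
  ∑ j, ((V j).depth + (collisionGates (X j) (Y j)).length)

/-- The law of the outcome when the observable `A` is measured in the state `ρ` (Born rule): the
eigenvalue of the `i`-th eigenvector `v_i` has probability `⟨v_i, ρ v_i⟩`. -/
def measureLaw {s : Type} [Fintype s] [DecidableEq s] {A : Matrix s s ℂ} (hA : A.IsHermitian)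
    (ρ : Matrix s s ℂ) : MeasureTheory.Measure ℝ :=
  ∑ i, ENNReal.ofReal
      ((star (hA.eigenvectorUnitary : Matrix s s ℂ) * ρ * (hA.eigenvectorUnitary : Matrix s s ℂ))
        i i).re
    • MeasureTheory.Measure.dirac (hA.eigenvalues i)

/-- The observable `σˣ ⊗ O` on ancilla and system. -/
def sigmaXO {n : ℕ} (O : QOp (Fin n)) : ASOp n := Pauli.X.mat ⊗ₖ O

theorem sigmaXO_isHermitian {n : ℕ} {O : QOp (Fin n)} (hO : O.IsHermitian) :
    (sigmaXO O).IsHermitian := by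
  have hX : (Pauli.X.mat)ᴴ = Pauli.X.mat := by
    ext i j
    fin_cases i <;> fin_cases j <;> simp [Pauli.mat]
  unfold Matrix.IsHermitian sigmaXO
  rw [Matrix.conjTranspose_kronecker, hX, hO.eq]

/-- The law of the outcome of one run: for every `j` the words `X_j, Y_j` are sampled
independently from the ensemble of the LCU `D j`, the circuit is run, and `σˣ ⊗ O` is measured. -/
def runLaw {n K : ℕ} {e : Fin K → ℕ} (ρS : QOp (Fin n)) (ρE : ∀ j, QOp (Fin (e j)))
    {O : QOp (Fin n)} (hO : O.IsHermitian) (D : ∀ j, LCU n (e j)) : MeasureTheory.Measure ℝ :=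
  ∑ a : ∀ j, (D j).Idx, ∑ b : ∀ j, (D j).Idx,
    ENNReal.ofReal (∏ j, (D j).prob (a j) * (D j).prob (b j))
      • measureLaw (sigmaXO_isHermitian hO)
          (finalState ρS ρE (fun j => (D j).word (a j)) (fun j => (D j).word (b j)))

/-- `ζ`, the product of the total weights of the LCUs. -/
def zeta {n K : ℕ} {e : Fin K → ℕ} (D : ∀ j, LCU n (e j)) : ℝ := ∏ j, (D j).weight

/-- The output `μ = ζ² / T * ∑ μ_i` computed from the outcomes of the `T` runs. -/
def estimate (ζ : ℝ) {T : ℕ} (m : Fin T → ℝ) : ℝ := ζ ^ 2 / T * ∑ i, m i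

/-- With probability at least `1 - δ`, the estimate computed from `T` independent runs of the
circuit is within `ε` of the (a priori complex) number `v`. -/
def Succeeds {n K : ℕ} {e : Fin K → ℕ} (ρS : QOp (Fin n)) (ρE : ∀ j, QOp (Fin (e j)))
    {O : QOp (Fin n)} (hO : O.IsHermitian) (D : ∀ j, LCU n (e j)) (T : ℕ) (v : ℂ)
    (ε δ : ℝ) : Prop :=
  ENNReal.ofReal (1 - δ) ≤
    MeasureTheory.Measure.pi (fun _ : Fin T => runLaw ρS ρE hO D)
      {m | ‖((estimate (zeta D) m : ℝ) : ℂ) - v‖ ≤ ε}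

end Collision

end

/-! Fix the sampled words. Every gate of a run is controlled on the ancilla, so a collision acts
block-diagonally, by `Y` on `|0⟩` and by `X` on `|1⟩`, and the ancilla blocks of the state evolve
separately: the block `⟨b|σ|b'⟩` undergoes `σ ↦ Tr_E [G_b (σ ⊗ ρ_E) G_{b'}†]` with `G_0 = Y`, `G_1 =
X`. Measuring `σˣ ⊗ O` reads off the two off-diagonal blocks. These are linear in `X` and
conjugate-linear in `Y`, or conversely, so averaging over independent samples restores the full
sums: `ζ²` times the mean outcome is exactly the expectation of `O` with every `U_j` replaced by its
LCU (`zeta_sq_mul_sum`).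

Two errors remain. Replacing `U_j` by an operator within `η` changes the final state by at most `(1
+ η)^(2K) - 1` in trace norm (`crossMap_sub_crossMap`), which costs at most `ε / 2` at the
prescribed precision. The outcomes lie in `[-‖O‖, ‖O‖]`, so Hoeffding's inequality bounds the
statistical error by the other `ε / 2` (`succeeds_of_bias`).

For the Taylor LCU, consecutive orders `k`, `k + 1` are merged into one Pauli rotation, because `√(1
+ y²) exp(-iθP) = 1 - iyP` when `tan θ = y`. The weight of a segment of length `x` is then at most
`√(1 + x²) cosh x ≤ exp(x²)`, with no linear term in the exponent. Over `r` segments and `K`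
collisions this gives `ζ ≤ exp(β²Δt²K / r)`, bounded as soon as `r ≥ β²Δt²K`. The truncation error
is at most `8βΔt / N!` with `N` about `q`, and Stirling's bound shows that `q` of order `log y / log
log y` suffices.

If `ε` exceeds a multiple of `‖O‖`, the bias estimate is not needed: the output and the target are
both bounded by multiples of `‖O‖` (`succeeds_of_bound`). -/

noncomputable section

namespace Collision

open MeasureTheory ProbabilityTheory


/-! ### Trace norm bounds, by duality -/

section TraceNorm

variable {s t u : Type} [Fintype s] [Fintype t] [Fintype u] [DecidableEq s] [DecidableEq t]
  [DecidableEq u]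

/-- The trace norm of `σ` is at most `c`, expressed by duality with the spectral norm. -/
def TraceNormLE (σ : Matrix s s ℂ) (c : ℝ) : Prop := ∀ A : Matrix s s ℂ, ‖(A * σ).trace‖ ≤ c * ‖A‖

theorem TraceNormLE.mono {σ : Matrix s s ℂ} {c d : ℝ} (h : TraceNormLE σ c) (hcd : c ≤ d) :
    TraceNormLE σ d := fun A => (h A).trans (mul_le_mul_of_nonneg_right hcd (norm_nonneg A))

theorem TraceNormLE.zero : TraceNormLE (0 : Matrix s s ℂ) 0 := fun A => by simp

theorem TraceNormLE.add {σ τ : Matrix s s ℂ} {c d : ℝ} (hσ : TraceNormLE σ c)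
    (hτ : TraceNormLE τ d) : TraceNormLE (σ + τ) (c + d) := fun A => by
  rw [mul_add, Matrix.trace_add, add_mul]
  exact (norm_add_le _ _).trans (add_le_add (hσ A) (hτ A))

theorem TraceNormLE.sum {ι : Type} (S : Finset ι) {σ : ι → Matrix s s ℂ} {c : ι → ℝ}
    (h : ∀ i ∈ S, TraceNormLE (σ i) (c i)) : TraceNormLE (∑ i ∈ S, σ i) (∑ i ∈ S, c i) := by
  intro A
  rw [Finset.mul_sum, Matrix.trace_sum, Finset.sum_mul]
  exact (norm_sum_le _ _).trans (Finset.sum_le_sum fun i hi => h i hi A)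

theorem TraceNormLE.conj {σ : Matrix s s ℂ} {c : ℝ} (h : TraceNormLE σ c) (hc : 0 ≤ c)
    (X Y : Matrix t s ℂ) : TraceNormLE (X * σ * Yᴴ) (‖X‖ * ‖Y‖ * c) := by
  intro A
  have e : (A * (X * σ * Yᴴ)).trace = ((Yᴴ * A * X) * σ).trace := by
    rw [← Matrix.mul_assoc, Matrix.trace_mul_comm]
    simp only [Matrix.mul_assoc]
  rw [e]
  have h1 : ‖Yᴴ * A * X‖ ≤ ‖Y‖ * ‖A‖ * ‖X‖ := by
    refine (Matrix.l2_opNorm_mul _ _).trans ?_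
    refine mul_le_mul_of_nonneg_right ?_ (norm_nonneg _)
    refine (Matrix.l2_opNorm_mul _ _).trans ?_
    rw [Matrix.l2_opNorm_conjTranspose]
  calc _ ≤ c * ‖Yᴴ * A * X‖ := h _
    _ ≤ c * (‖Y‖ * ‖A‖ * ‖X‖) := mul_le_mul_of_nonneg_left h1 hc
    _ = _ := by ring

theorem norm_one_le : ‖(1 : Matrix s s ℂ)‖ ≤ 1 := by
  rw [← Matrix.diagonal_one, Matrix.l2_opNorm_diagonal]
  exact (pi_norm_le_iff_of_nonneg zero_le_one).2 fun i => by simp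

/-- The embedding `A ↦ A ⊗ 1`, as a homomorphism of C⋆-algebras. -/
def kroneckerOneHom (s t : Type) [Fintype s] [Fintype t] [DecidableEq s] [DecidableEq t] :
    Matrix s s ℂ →⋆ₐ[ℂ] Matrix (s × t) (s × t) ℂ where
  toFun A := A ⊗ₖ (1 : Matrix t t ℂ)
  map_one' := Matrix.one_kronecker_one
  map_mul' A B := by rw [← Matrix.mul_kronecker_mul, one_mul]
  map_zero' := Matrix.zero_kronecker _
  map_add' A B := Matrix.add_kronecker _ _ _
  commutes' c := by
    rw [Algebra.algebraMap_eq_smul_one, Algebra.algebraMap_eq_smul_one, Matrix.smul_kronecker,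
      Matrix.one_kronecker_one]
  map_star' A := by simp [Matrix.star_eq_conjTranspose, Matrix.conjTranspose_kronecker]

/-- Star homomorphisms between C⋆-algebras are contractive. -/
theorem norm_kronecker_one_le (A : Matrix s s ℂ) : ‖A ⊗ₖ (1 : Matrix t t ℂ)‖ ≤ ‖A‖ :=
  NonUnitalStarAlgHom.norm_apply_le (kroneckerOneHom s t) A

/-- The embedding `A ↦ 1 ⊗ A`, as a homomorphism of C⋆-algebras. -/
def oneKroneckerHom (s t : Type) [Fintype s] [Fintype t] [DecidableEq s] [DecidableEq t] :
    Matrix s s ℂ →⋆ₐ[ℂ] Matrix (t × s) (t × s) ℂ where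
  toFun A := (1 : Matrix t t ℂ) ⊗ₖ A
  map_one' := Matrix.one_kronecker_one
  map_mul' A B := by rw [← Matrix.mul_kronecker_mul, one_mul]
  map_zero' := Matrix.kronecker_zero _
  map_add' A B := Matrix.kronecker_add _ _ _
  commutes' c := by
    rw [Algebra.algebraMap_eq_smul_one, Algebra.algebraMap_eq_smul_one, Matrix.kronecker_smul,
      Matrix.one_kronecker_one]
  map_star' A := by simp [Matrix.star_eq_conjTranspose, Matrix.conjTranspose_kronecker]

theorem norm_one_kronecker_le (A : Matrix s s ℂ) : ‖(1 : Matrix t t ℂ) ⊗ₖ A‖ ≤ ‖A‖ :=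
  NonUnitalStarAlgHom.norm_apply_le (oneKroneckerHom s t) A

-- The partial trace is dual to `A ↦ A ⊗ 1`; hence it does not increase the trace norm.
omit [DecidableEq s] in
theorem trace_mul_ptrace (A : Matrix s s ℂ) (M : Matrix (s × t) (s × t) ℂ) :
    (A * ptrace M).trace = ((A ⊗ₖ (1 : Matrix t t ℂ)) * M).trace := by
  simp only [Matrix.trace, Matrix.diag_apply, Matrix.mul_apply, ptrace, Matrix.of_apply,
    Fintype.sum_prod_type, Matrix.kroneckerMap_apply, Matrix.one_apply, mul_ite, mul_one, mul_zero,
    ite_mul, zero_mul, Finset.sum_ite_eq, Finset.mem_univ, if_true, Finset.mul_sum]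
  refine Finset.sum_congr rfl fun i _ => ?_
  rw [Finset.sum_comm]

theorem TraceNormLE.ptrace {M : Matrix (s × t) (s × t) ℂ} {c : ℝ} (h : TraceNormLE M c)
    (hc : 0 ≤ c) : TraceNormLE (ptrace M) c := fun A => by
  rw [trace_mul_ptrace]
  exact (h _).trans (mul_le_mul_of_nonneg_left (norm_kronecker_one_le A) hc)

/-- The case of a one-dimensional environment: conjugation by the isometry that identifies `s` with
`s × Unit`. -/
theorem TraceNormLE.kronecker_unit {σ : Matrix s s ℂ} {c : ℝ} (h : TraceNormLE σ c)
    (hc : 0 ≤ c) : TraceNormLE (σ ⊗ₖ (1 : Matrix Unit Unit ℂ)) c := by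
  have e : σ ⊗ₖ (1 : Matrix Unit Unit ℂ) =
      (Matrix.of fun (p : s × Unit) (y : s) => if p.1 = y then (1 : ℂ) else 0) * σ *
        (Matrix.of fun (p : s × Unit) (y : s) => if p.1 = y then (1 : ℂ) else 0)ᴴ := by
    ext ⟨x, _⟩ ⟨y, _⟩
    simp [Matrix.mul_apply, apply_ite]
  have hX : ‖(Matrix.of fun (p : s × Unit) (y : s) => if p.1 = y then (1 : ℂ) else 0)‖ ≤ 1 := by
    set X := (Matrix.of fun (p : s × Unit) (y : s) => if p.1 = y then (1 : ℂ) else 0)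
    have hXX : Xᴴ * X = 1 := by
      ext x y
      simp [X, Matrix.mul_apply, Fintype.sum_prod_type, Matrix.one_apply, apply_ite, eq_comm]
    have := Matrix.l2_opNorm_conjTranspose_mul_self X
    rw [hXX] at this
    have h1 := norm_one_le (s := s)
    nlinarith [norm_nonneg X]
  rw [e]
  refine (h.conj hc _ _).mono ?_
  calc _ ≤ 1 * 1 * c := by gcongr
    _ = c := by ring

-- With `ρ = C†C`, the `w z` are the adjoints of the rows of `C`. They are kept as one-column
-- matrices so that `1 ⊗ w z` is again a matrix.
open scoped MatrixOrder in
theorem IsDensity.exists_eq_sum {ρ : Matrix t t ℂ} (hρ : IsDensity ρ) :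
    ∃ w : t → Matrix t Unit ℂ, ρ = ∑ z, w z * (w z)ᴴ ∧ ∑ z, ((w z)ᴴ * w z) () () = 1 := by
  obtain ⟨C, hC⟩ := CStarAlgebra.nonneg_iff_eq_star_mul_self.mp hρ.1.nonneg
  refine ⟨fun z => Matrix.of fun x _ => star (C z x), ?_, ?_⟩
  · rw [hC]
    ext x y
    simp [Matrix.mul_apply, Matrix.sum_apply, Matrix.star_eq_conjTranspose]
  · have := hρ.2
    rw [hC] at this
    rw [← this, Matrix.trace]
    simp only [Matrix.mul_apply, Matrix.diag_apply, Matrix.star_eq_conjTranspose,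
      Matrix.conjTranspose_apply, Matrix.of_apply, star_star]
    rw [Finset.sum_comm]
    exact Finset.sum_congr rfl fun _ _ => Finset.sum_congr rfl fun _ _ => mul_comm _ _

/-- Decomposing `ρ = ∑ w w†` writes `σ ⊗ ρ` as a sum of conjugates of `σ ⊗ 1` by `1 ⊗ w`, whose
squared norms are at most `‖w‖²` and so add up to at most `tr ρ = 1`. -/
theorem TraceNormLE.kronecker {σ : Matrix s s ℂ} {c : ℝ} (h : TraceNormLE σ c) (hc : 0 ≤ c)
    {ρ : Matrix t t ℂ} (hρ : IsDensity ρ) : TraceNormLE (σ ⊗ₖ ρ) c := by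
  obtain ⟨w, hw, hw1⟩ := hρ.exists_eq_sum
  have hpos : ∀ z, 0 ≤ ((w z)ᴴ * w z) () () := fun z =>
    (Matrix.posSemidef_conjTranspose_mul_self (w z)).diag_nonneg
  have e : σ ⊗ₖ ρ = ∑ z, ((1 : Matrix s s ℂ) ⊗ₖ w z) * (σ ⊗ₖ (1 : Matrix Unit Unit ℂ)) *
      ((1 : Matrix s s ℂ) ⊗ₖ w z)ᴴ := by
    simp only [Matrix.conjTranspose_kronecker, ← Matrix.mul_kronecker_mul, Matrix.mul_one,
      Matrix.one_mul, Matrix.conjTranspose_one]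
    rw [hw]
    ext ⟨x, x'⟩ ⟨y, y'⟩
    simp [Matrix.sum_apply, Finset.mul_sum]
  have hn : ∀ z, ‖(1 : Matrix s s ℂ) ⊗ₖ w z‖ * ‖(1 : Matrix s s ℂ) ⊗ₖ w z‖ ≤
      (((w z)ᴴ * w z) () ()).re := by
    intro z
    rw [← Matrix.l2_opNorm_conjTranspose_mul_self, Matrix.conjTranspose_kronecker,
      ← Matrix.mul_kronecker_mul, Matrix.conjTranspose_one, Matrix.one_mul]
    have : (1 : Matrix s s ℂ) ⊗ₖ ((w z)ᴴ * w z) =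
        (((w z)ᴴ * w z) () ()) • (1 : Matrix (s × Unit) (s × Unit) ℂ) := by
      ext ⟨x, _⟩ ⟨y, _⟩
      simp [Matrix.one_apply]
    have hre : ‖((w z)ᴴ * w z) () ()‖ = (((w z)ᴴ * w z) () ()).re :=
      RCLike.ofReal_injective (K := ℂ) ((Complex.norm_of_nonneg' (hpos z)).trans
        (Complex.eq_re_of_ofReal_le (r := 0) (hpos z)))
    rw [this, norm_smul, hre]
    refine mul_le_of_le_one_right ?_ norm_one_le
    rw [← hre]
    exact norm_nonneg _
  rw [e]
  refine (TraceNormLE.sum Finset.univ fun z _ => (h.kronecker_unit hc).conj hc _ _).mono ?_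
  rw [← Finset.sum_mul]
  have h1 : ∑ z, (((w z)ᴴ * w z) () ()).re = 1 := by
    rw [← Complex.re_sum, hw1, Complex.one_re]
  calc _ ≤ (∑ z, (((w z)ᴴ * w z) () ()).re) * c :=
        mul_le_mul_of_nonneg_right (Finset.sum_le_sum fun z _ => hn z) hc
    _ = c := by rw [h1, one_mul]

/-- The previous bound with a one-dimensional first factor. -/
theorem IsDensity.traceNormLE {ρ : Matrix s s ℂ} (hρ : IsDensity ρ) : TraceNormLE ρ 1 := by
  have h0 : TraceNormLE (1 : Matrix Unit Unit ℂ) 1 := fun A => by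
    have : (A * 1).trace = (1 * A * 1 : Matrix Unit Unit ℂ) () () := by simp [Matrix.trace]
    have hA : A = Matrix.diagonal fun _ => A () () := by
      ext i j; simp
    rw [mul_one, one_mul]
    conv_rhs => rw [hA, Matrix.l2_opNorm_diagonal]
    simp [Matrix.trace]
  have h1 := h0.kronecker zero_le_one hρ
  intro A
  have := h1 ((1 : Matrix Unit Unit ℂ) ⊗ₖ A)
  have hA : ‖(1 : Matrix Unit Unit ℂ) ⊗ₖ A‖ ≤ ‖A‖ := norm_one_kronecker_le A
  rw [← Matrix.mul_kronecker_mul, Matrix.trace_kronecker, one_mul, Matrix.trace_one] at this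
  simp only [Fintype.card_unit, Nat.cast_one, one_mul] at this
  simpa using this.trans hA

/-! ### Density operators -/

theorem IsDensity.conj {ρ : Matrix s s ℂ} (hρ : IsDensity ρ) {U : Matrix s s ℂ}
    (hU : U ∈ unitary (Matrix s s ℂ)) : IsDensity (U * ρ * Uᴴ) := by
  refine ⟨hρ.1.mul_mul_conjTranspose_same U, ?_⟩
  rw [Matrix.trace_mul_comm, ← mul_assoc, ← Matrix.star_eq_conjTranspose,
    Unitary.star_mul_self_of_mem hU, one_mul, hρ.2]

omit [DecidableEq s] [DecidableEq t] in
theorem IsDensity.kronecker {ρ : Matrix s s ℂ} (hρ : IsDensity ρ) {τ : Matrix t t ℂ}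
    (hτ : IsDensity τ) : IsDensity (ρ ⊗ₖ τ) :=
  ⟨hρ.1.kronecker hτ.1, by rw [Matrix.trace_kronecker, hρ.2, hτ.2, one_mul]⟩

omit [DecidableEq s] [DecidableEq t] in
theorem IsDensity.ptrace {M : Matrix (s × t) (s × t) ℂ} (h : IsDensity M) :
    IsDensity (ptrace M) := by
  constructor
  · have : Collision.ptrace M = ∑ z, M.submatrix (fun x => (x, z)) (fun x => (x, z)) := by
      ext x y
      simp [Collision.ptrace, Matrix.sum_apply]
    rw [this]
    exact Matrix.posSemidef_sum _ fun z _ => h.1.submatrix _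
  · rw [← h.2]
    simp [Matrix.trace, Collision.ptrace, Fintype.sum_prod_type]

end TraceNorm

/-! ### Prepared states -/

/-- Splitting the qubits into the support and its complement turns the operator into `g ⊗ 1`. -/
theorem LocalGate.toOp_mem_unitary {ι : Type} [Fintype ι] [DecidableEq ι] (g : LocalGate ι) :
    g.toOp ∈ unitary (QOp ι) := by
  let e := Equiv.piEquivPiSubtypeProd (fun i => i ∈ g.supp) (fun _ : ι => Fin 2)
  have h : g.toOp = Matrix.reindexAlgEquiv ℂ ℂ e.symm
      ((g.mat : Matrix (g.supp → Fin 2) (g.supp → Fin 2) ℂ) ⊗ₖ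
        (1 : Matrix ({i // i ∉ g.supp} → Fin 2) ({i // i ∉ g.supp} → Fin 2) ℂ)) := by
    ext x y
    simp [LocalGate.toOp, e, Matrix.one_apply, funext_iff, Equiv.piEquivPiSubtypeProd]
  have hu : (g.mat : Matrix (g.supp → Fin 2) (g.supp → Fin 2) ℂ) ⊗ₖ
        (1 : Matrix ({i // i ∉ g.supp} → Fin 2) ({i // i ∉ g.supp} → Fin 2) ℂ) ∈ unitary _ :=
    Unitary.map_mem (kroneckerOneHom _ _) g.mat.2
  rw [h]
  rw [Unitary.mem_iff] at hu ⊢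
  have hs : ∀ A, star (Matrix.reindexAlgEquiv ℂ ℂ e.symm A) =
    Matrix.reindexAlgEquiv ℂ ℂ e.symm (star A) := fun A => rfl
  rw [hs, ← map_mul, ← map_mul, hu.1, hu.2, map_one]
  exact ⟨rfl, rfl⟩

theorem list_prod_map_mem_unitary {α R : Type} [Semiring R] [StarRing R] (f : α → R)
    (hf : ∀ a, f a ∈ unitary R) (l : List α) : (l.map f).prod ∈ unitary R :=
  list_prod_mem (S := unitary R) fun x hx => by
    obtain ⟨a, -, rfl⟩ := List.mem_map.1 hx
    exact hf a

theorem Layer.toOp_mem_unitary {ι : Type} [Fintype ι] [DecidableEq ι] (l : Layer ι) :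
    l.toOp ∈ unitary (QOp ι) := by
  unfold Layer.toOp
  exact list_prod_map_mem_unitary _ LocalGate.toOp_mem_unitary l.gates

theorem PrepCircuit.toOp_mem_unitary {e : ℕ} (V : PrepCircuit e) :
    V.toOp ∈ unitary (QOp (Fin e ⊕ Fin V.work)) := by
  unfold PrepCircuit.toOp
  exact list_prod_map_mem_unitary _ Layer.toOp_mem_unitary V.layers

/-- The first column of the circuit unitary, reshaped as a register-by-work matrix `C`, gives the
state as `C C†`; its trace is the squared norm of a column of a unitary. -/
theorem PrepCircuit.isDensity_state {e : ℕ} (V : PrepCircuit e) : IsDensity V.state := by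
  let C : Matrix (Fin e → Fin 2) (Fin V.work → Fin 2) ℂ :=
    Matrix.of fun x z => V.toOp (Sum.elim x z) (fun _ => 0)
  have hC : V.state = C * Cᴴ := by
    ext x y
    simp [PrepCircuit.state, C, Matrix.mul_apply]
  constructor
  · rw [hC]
    exact Matrix.posSemidef_self_mul_conjTranspose C
  · have h0 : star V.toOp * V.toOp = (1 : QOp (Fin e ⊕ Fin V.work)) :=
      Unitary.star_mul_self_of_mem V.toOp_mem_unitary
    have h := congrFun (congrFun h0 fun _ => 0) fun _ => 0
    rw [Matrix.one_apply_eq, Matrix.mul_apply,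
      ← (Equiv.sumArrowEquivProdArrow (Fin e) (Fin V.work) (Fin 2)).symm.sum_comp,
      Fintype.sum_prod_type] at h
    rw [← h, Matrix.trace]
    refine Finset.sum_congr rfl fun x _ => Finset.sum_congr rfl fun z _ => ?_
    rw [Matrix.star_apply, mul_comm]
    rfl


/-! ### The maps `σ ↦ Tr_E [A (σ ⊗ ρ_E) B†]` and their compositions -/

/-- The linear map `σ ↦ Tr_E [A (σ ⊗ ρ_E) B†]`. -/
def channel {n e : ℕ} (ρE : QOp (Fin e)) (A B : SEOp n e) : QOp (Fin n) →ₗ[ℂ] QOp (Fin n) where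
  toFun σ := ptrace (A * (σ ⊗ₖ ρE) * Bᴴ)
  map_add' σ τ := by
    rw [Matrix.add_kronecker, mul_add, add_mul]
    ext x y
    simp [ptrace, Finset.sum_add_distrib]
  map_smul' c σ := by
    rw [Matrix.smul_kronecker, Matrix.mul_smul, Matrix.smul_mul]
    ext x y
    simp [ptrace, Finset.mul_sum]

theorem channel_apply {n e : ℕ} (ρE : QOp (Fin e)) (A B : SEOp n e) (σ : QOp (Fin n)) :
    channel ρE A B σ = ptrace (A * (σ ⊗ₖ ρE) * Bᴴ) := rfl

theorem channel_sum_left {n e : ℕ} (ρE : QOp (Fin e)) {ι : Type} [Fintype ι] (c : ι → ℂ)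
    (A : ι → SEOp n e) (B : SEOp n e) (σ : QOp (Fin n)) :
    channel ρE (∑ k, c k • A k) B σ = ∑ k, c k • channel ρE (A k) B σ := by
  simp only [channel_apply, Finset.sum_mul, Matrix.smul_mul]
  ext x y
  simp only [ptrace, Matrix.of_apply, Matrix.sum_apply, Matrix.smul_apply, smul_eq_mul,
    Finset.mul_sum]
  exact Finset.sum_comm

theorem channel_sum_right {n e : ℕ} (ρE : QOp (Fin e)) {ι : Type} [Fintype ι] (c : ι → ℝ)
    (A : SEOp n e) (B : ι → SEOp n e) (σ : QOp (Fin n)) :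
    channel ρE A (∑ k, (c k : ℂ) • B k) σ = ∑ k, (c k : ℂ) • channel ρE A (B k) σ := by
  simp only [channel_apply, Matrix.conjTranspose_sum, Matrix.conjTranspose_smul, Finset.mul_sum,
    Matrix.mul_smul, Complex.star_def, Complex.conj_ofReal]
  ext x y
  simp only [ptrace, Matrix.of_apply, Matrix.sum_apply, Matrix.smul_apply, smul_eq_mul,
    Finset.mul_sum]
  exact Finset.sum_comm

/-- The composition of the maps `channel (ρE j) (A j) (B j)`, applied to `ρ`. -/
def crossMap {n K : ℕ} {e : Fin K → ℕ} (ρE : ∀ j, QOp (Fin (e j))) (A B : ∀ j, SEOp n (e j))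
    (ρ : QOp (Fin n)) : QOp (Fin n) :=
  Fin.foldl K (fun σ j => channel (ρE j) (A j) (B j) σ) ρ

theorem crossMap_smul {n K : ℕ} {e : Fin K → ℕ} (ρE : ∀ j, QOp (Fin (e j)))
    (A B : ∀ j, SEOp n (e j)) (c : ℂ) (ρ : QOp (Fin n)) :
    crossMap ρE A B (c • ρ) = c • crossMap ρE A B ρ := by
  induction K with
  | zero => simp [crossMap]
  | succ K ih =>
    have := ih (fun j => ρE j.castSucc) (fun j => A j.castSucc) (fun j => B j.castSucc)
    simp only [crossMap] at this ⊢
    rw [Fin.foldl_succ_last, Fin.foldl_succ_last, this, map_smul]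

theorem TraceNormLE.channel {n e : ℕ} {ρE : QOp (Fin e)} (hE : IsDensity ρE) (A B : SEOp n e)
    {σ : QOp (Fin n)} {c : ℝ} (h : TraceNormLE σ c) (hc : 0 ≤ c) :
    TraceNormLE (channel ρE A B σ) (‖A‖ * ‖B‖ * c) :=
  ((h.kronecker hc hE).conj hc A B).ptrace (by positivity)

/-- Both bounds are proved in one induction, since the error of the last collision acts on the exact
state, whose trace norm must be known. -/
theorem crossMap_sub_crossMap {n K : ℕ} {e : Fin K → ℕ} {ρE : ∀ j, QOp (Fin (e j))}
    (hE : ∀ j, IsDensity (ρE j)) {U W : ∀ j, SEOp n (e j)} {η : ℝ} (hη : 0 ≤ η)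
    (hU : ∀ j, ‖U j‖ ≤ 1) (h : ∀ j, ‖U j - W j‖ ≤ η) {ρ : QOp (Fin n)} (hρ : IsDensity ρ) :
    TraceNormLE (crossMap ρE U U ρ) 1 ∧
      TraceNormLE (crossMap ρE W W ρ - crossMap ρE U U ρ) ((1 + η) ^ (2 * K) - 1) := by
  induction K with
  | zero => simpa [crossMap] using ⟨hρ.traceNormLE, TraceNormLE.zero⟩
  | succ K ih =>
    obtain ⟨h1, h2⟩ := ih (fun j => hE j.castSucc) (fun j => hU j.castSucc)
      (fun j => h j.castSucc)
    have hp : (1 : ℝ) ≤ (1 + η) ^ (2 * K) := one_le_pow₀ (by linarith)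
    simp only [crossMap] at h1 h2 ⊢
    simp only [Fin.foldl_succ_last]
    set σ := Fin.foldl K (fun σ j => Collision.channel (ρE j.castSucc) (U j.castSucc)
      (U j.castSucc) σ) ρ
    set τ := Fin.foldl K (fun σ j => Collision.channel (ρE j.castSucc) (W j.castSucc)
      (W j.castSucc) σ) ρ
    set u := U (Fin.last K)
    set w := W (Fin.last K)
    have hu : ‖u‖ ≤ 1 := hU _
    have hd : ‖w - u‖ ≤ η := by rw [norm_sub_rev]; exact h _
    have hw : ‖w‖ ≤ 1 + η := by
      have := norm_add_le u (w - u)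
      rw [add_sub_cancel] at this
      linarith
    refine ⟨(h1.channel (hE _) u u zero_le_one).mono ?_, ?_⟩
    · nlinarith [norm_nonneg u]
    -- Telescoping: the inherited error, then the last left factor, then the last right one. The
    -- bounds add up by `(1+η)²(D - 1) + η(1+η) + η = (1+η)²D - 1`.
    have e : Collision.channel (ρE (Fin.last K)) w w τ - Collision.channel (ρE (Fin.last K)) u u σ =
        Collision.channel (ρE (Fin.last K)) w w (τ - σ) +
          Collision.channel (ρE (Fin.last K)) (w - u) w σ +
          Collision.channel (ρE (Fin.last K)) u (w - u) σ := by
      rw [map_sub]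
      have a1 : Collision.channel (ρE (Fin.last K)) (w - u) w σ =
          Collision.channel (ρE (Fin.last K)) w w σ - Collision.channel (ρE (Fin.last K)) u w σ := by
        simp only [channel_apply, sub_mul]
        ext x y; simp [ptrace]
      have a2 : Collision.channel (ρE (Fin.last K)) u (w - u) σ =
          Collision.channel (ρE (Fin.last K)) u w σ - Collision.channel (ρE (Fin.last K)) u u σ := by
        simp only [channel_apply, Matrix.conjTranspose_sub, mul_sub]
        ext x y; simp [ptrace]
      rw [a1, a2]
      abel
    rw [e]
    refine (((h2.channel (hE _) w w (by linarith)).add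
      (h1.channel (hE _) (w - u) w zero_le_one)).add
      (h1.channel (hE _) u (w - u) zero_le_one)).mono ?_
    have b1 : ‖w‖ * ‖w‖ * ((1 + η) ^ (2 * K) - 1) ≤ (1 + η) * (1 + η) * ((1 + η) ^ (2 * K) - 1) := by
      gcongr
    have b2 : ‖w - u‖ * ‖w‖ * 1 ≤ η * (1 + η) * 1 := by gcongr
    have b3 : ‖u‖ * ‖w - u‖ * 1 ≤ 1 * η * 1 := by gcongr
    calc _ ≤ (1 + η) * (1 + η) * ((1 + η) ^ (2 * K) - 1) + η * (1 + η) * 1 + 1 * η * 1 := by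
          linarith
      _ = _ := by ring

/-! ### Expanding compositions and powers of sums -/

theorem foldl_sum_smul {E : Type} [AddCommGroup E] [Module ℂ E] {K : ℕ} {Idx : Fin K → Type}
    [∀ j, Fintype (Idx j)] (c : ∀ j, Idx j → ℂ) (F : ∀ j, Idx j → E →ₗ[ℂ] E) (x : E) :
    Fin.foldl K (fun σ j => ∑ k, c j k • F j k σ) x =
      ∑ a : ∀ j, Idx j, (∏ j, c j (a j)) • Fin.foldl K (fun σ j => F j (a j) σ) x := by
  induction K with
  | zero => simp
  | succ K ih =>
    rw [Fin.foldl_succ_last, ih (fun j => c j.castSucc) (fun j => F j.castSucc),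
      ← (Fin.snocEquiv Idx).sum_comp, Fintype.sum_prod_type]
    refine Finset.sum_congr rfl fun k _ => ?_
    rw [map_sum, Finset.smul_sum]
    refine Finset.sum_congr rfl fun a _ => ?_
    rw [Fin.foldl_succ_last, Fin.prod_univ_castSucc]
    simp only [Fin.snocEquiv, Equiv.coe_fn_mk, Fin.snoc_castSucc, Fin.snoc_last]
    rw [map_smul, smul_smul, mul_comm]

theorem pow_sum_smul {R : Type} [Ring R] [Algebra ℂ R] {ι : Type} [Fintype ι] (c : ι → ℂ)
    (A : ι → R) (r : ℕ) :
    (∑ k, c k • A k) ^ r = ∑ a : Fin r → ι, (∏ s, c (a s)) • (List.ofFn fun s => A (a s)).prod := by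
  induction r with
  | zero => simp
  | succ r ih =>
    rw [pow_succ', ih, ← (Fin.consEquiv fun _ => ι).sum_comp, Fintype.sum_prod_type,
      Finset.sum_mul]
    refine Finset.sum_congr rfl fun k _ => ?_
    rw [Finset.mul_sum]
    refine Finset.sum_congr rfl fun a _ => ?_
    rw [Fin.prod_univ_succ, List.ofFn_succ, List.prod_cons]
    simp only [Fin.consEquiv, Equiv.coe_fn_mk, Fin.cons_succ, Fin.cons_zero]
    rw [smul_mul_smul_comm]

theorem crossMap_op_op {n K : ℕ} {e : Fin K → ℕ} (ρE : ∀ j, QOp (Fin (e j)))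
    (D : ∀ j, LCU n (e j)) (ρ : QOp (Fin n)) :
    crossMap ρE (fun j => (D j).op) (fun j => (D j).op) ρ =
      ∑ a : ∀ j, (D j).Idx, ∑ b : ∀ j, (D j).Idx,
        ((∏ j, ((D j).coeff (a j) : ℂ)) * ∏ j, ((D j).coeff (b j) : ℂ)) •
          crossMap ρE (fun j => wordMat ((D j).word (a j))) (fun j => wordMat ((D j).word (b j)))
            ρ := by
  have h1 : crossMap ρE (fun j => (D j).op) (fun j => (D j).op) ρ =
      ∑ a : ∀ j, (D j).Idx, (∏ j, ((D j).coeff (a j) : ℂ)) •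
        crossMap ρE (fun j => wordMat ((D j).word (a j))) (fun j => (D j).op) ρ := by
    simp only [crossMap, LCU.op, channel_sum_left]
    exact foldl_sum_smul (fun j k => ((D j).coeff k : ℂ))
      (fun j k => channel (ρE j) (wordMat ((D j).word k)) _) ρ
  rw [h1]
  refine Finset.sum_congr rfl fun a _ => ?_
  have h2 : crossMap ρE (fun j => wordMat ((D j).word (a j))) (fun j => (D j).op) ρ =
      ∑ b : ∀ j, (D j).Idx, (∏ j, ((D j).coeff (b j) : ℂ)) •
        crossMap ρE (fun j => wordMat ((D j).word (a j)))
          (fun j => wordMat ((D j).word (b j))) ρ := by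
    simp only [crossMap, LCU.op, channel_sum_right]
    exact foldl_sum_smul (fun j k => ((D j).coeff k : ℂ))
      (fun j k => channel (ρE j) (wordMat ((D j).word (a j))) (wordMat ((D j).word k))) ρ
  rw [h2, Finset.smul_sum]
  simp only [smul_smul]

/-! ### The ancilla blocks of the final state -/

/-- The operator which applies `G b` when the ancilla is in the state `|b⟩`. -/
def ancillaDiag {n e : ℕ} (G : Fin 2 → SEOp n e) :
    Matrix ((Fin 2 × (Fin n → Fin 2)) × (Fin e → Fin 2))
      ((Fin 2 × (Fin n → Fin 2)) × (Fin e → Fin 2)) ℂ :=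
  Matrix.of fun p q => if p.1.1 = q.1.1 then G p.1.1 (p.1.2, p.2) (q.1.2, q.2) else 0

theorem ancillaDiag_one {n e : ℕ} : ancillaDiag (1 : Fin 2 → SEOp n e) = 1 := by
  ext ⟨⟨b, x⟩, z⟩ ⟨⟨b', y⟩, w⟩
  by_cases h : b = b' <;> simp [ancillaDiag, Matrix.one_apply, h]

theorem ancillaDiag_mul {n e : ℕ} (G H : Fin 2 → SEOp n e) :
    ancillaDiag (G * H) = ancillaDiag G * ancillaDiag H := by
  ext ⟨⟨b, x⟩, z⟩ ⟨⟨b', y⟩, w⟩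
  by_cases h : b = b'
  · subst h
    simp [ancillaDiag, Matrix.mul_apply, Fintype.sum_prod_type, ite_mul]
  · simp [ancillaDiag, Matrix.mul_apply, Fintype.sum_prod_type, h]

theorem ancillaDiag_conjTranspose {n e : ℕ} (G : Fin 2 → SEOp n e) :
    (ancillaDiag G)ᴴ = ancillaDiag (star G) := by
  ext ⟨⟨b, x⟩, z⟩ ⟨⟨b', y⟩, w⟩
  by_cases h : b = b'
  · subst h
    simp [ancillaDiag]
  · simp [ancillaDiag, h, Ne.symm h]

theorem ancillaDiag_mem_unitary {n e : ℕ} {G : Fin 2 → SEOp n e} (h : ∀ b, G b ∈ unitary _) :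
    ancillaDiag G ∈ unitary (Matrix ((Fin 2 × (Fin n → Fin 2)) × (Fin e → Fin 2))
      ((Fin 2 × (Fin n → Fin 2)) × (Fin e → Fin 2)) ℂ) := by
  rw [Unitary.mem_iff, Matrix.star_eq_conjTranspose, ancillaDiag_conjTranspose,
    ← ancillaDiag_mul, ← ancillaDiag_mul, ← ancillaDiag_one]
  constructor <;> congr 1 <;> funext b
  · exact Unitary.star_mul_self_of_mem (h b)
  · exact Unitary.mul_star_self_of_mem (h b)

theorem ctrlMat_eq {n e : ℕ} (b : Fin 2) (G : SEOp n e) :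
    ctrlMat b G = ancillaDiag (Function.update 1 b G) := by
  ext ⟨⟨c, x⟩, z⟩ ⟨⟨c', y⟩, w⟩
  fin_cases b <;> fin_cases c <;> fin_cases c' <;>
    simp [ctrlMat, ancillaDiag, Matrix.one_apply]

/-- Ancilla-diagonal operators multiply blockwise, so the gates controlled on one ancilla value
collect into a single word in that block. -/
theorem collisionOp_eq {n e : ℕ} (X Y : List (PauliGate n e)) :
    collisionOp X Y = ancillaDiag ![wordMat Y, wordMat X] := by
  have h : ∀ (b : Fin 2) (l : List (PauliGate n e)),
      ((l.map fun g => (b, g)).map fun g : Fin 2 × PauliGate n e => ctrlMat g.1 g.2.mat).prod =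
        ancillaDiag (Function.update 1 b (wordMat l)) := by
    intro b l
    induction l with
    | nil => simp [wordMat, ancillaDiag_one]
    | cons g l ih =>
      rw [List.map_cons, List.map_cons, List.prod_cons, ih, ctrlMat_eq, ← ancillaDiag_mul,
        ← Function.update_mul]
      simp [wordMat]
  rw [collisionOp, collisionGates, List.map_append, List.prod_append, h, h, ← ancillaDiag_mul]
  congr 1
  funext b
  fin_cases b <;> simp

/-- The block `⟨b| σ |b'⟩` of an operator on ancilla and system. -/
def ancillaBlock {n : ℕ} (σ : ASOp n) (b b' : Fin 2) : QOp (Fin n) :=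
  Matrix.of fun x y => σ (b, x) (b', y)

theorem ancillaBlock_ptrace {n e : ℕ} (G : Fin 2 → SEOp n e) (σ : ASOp n) (ρE : QOp (Fin e))
    (b b' : Fin 2) :
    ancillaBlock (ptrace (ancillaDiag G * (σ ⊗ₖ ρE) * (ancillaDiag G)ᴴ)) b b' =
      channel ρE (G b) (G b') (ancillaBlock σ b b') := by
  ext x y
  simp only [ancillaBlock, ptrace, channel_apply, Matrix.of_apply]
  refine Finset.sum_congr rfl fun z _ => ?_
  simp only [Matrix.mul_apply, Fintype.sum_prod_type, ancillaDiag, Matrix.of_apply,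
    Matrix.conjTranspose_apply, Matrix.kroneckerMap_apply]
  rw [Finset.sum_eq_single b' (fun c _ hc => by simp [Ne.symm hc]) (by simp)]
  refine Finset.sum_congr rfl fun _ _ => Finset.sum_congr rfl fun _ _ => ?_
  rw [Finset.sum_eq_single b (fun c _ hc => by simp [Ne.symm hc]) (by simp)]
  simp

theorem ancillaBlock_finalState {n K : ℕ} {e : Fin K → ℕ} (ρS : QOp (Fin n))
    (ρE : ∀ j, QOp (Fin (e j))) (X Y : ∀ j, List (PauliGate n (e j))) (b b' : Fin 2) :
    ancillaBlock (finalState ρS ρE X Y) b b' =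
      (1 / 2 : ℂ) • crossMap ρE (fun j => ![wordMat (Y j), wordMat (X j)] b)
        (fun j => ![wordMat (Y j), wordMat (X j)] b') ρS := by
  rw [← crossMap_smul]
  have h0 : ancillaBlock (plusState ⊗ₖ ρS) b b' = (1 / 2 : ℂ) • ρS := by
    ext x y; simp [ancillaBlock, plusState]
  rw [← h0, finalState]
  generalize plusState ⊗ₖ ρS = σ
  induction K with
  | zero => simp [crossMap]
  | succ K ih =>
    have := ih (fun j => ρE j.castSucc) (fun j => X j.castSucc) (fun j => Y j.castSucc)
    simp only [crossMap] at this ⊢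
    rw [Fin.foldl_succ_last, Fin.foldl_succ_last, ← this, collisionOp_eq, ancillaBlock_ptrace]

theorem trace_sigmaXO_mul {n : ℕ} (O : QOp (Fin n)) (σ : ASOp n) :
    (sigmaXO O * σ).trace = (O * ancillaBlock σ 1 0).trace + (O * ancillaBlock σ 0 1).trace := by
  simp [Matrix.trace, Matrix.mul_apply, sigmaXO, Fintype.sum_prod_type, ancillaBlock, Pauli.mat]

theorem LCU.weight_mul_prob {n e : ℕ} (D : LCU n e) (h : D.weight ≠ 0) (k : D.Idx) :
    D.weight * D.prob k = D.coeff k := by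
  rw [LCU.prob]; field_simp

/-- Unbiasedness: sampling followed by rescaling with `ζ²` reproduces the sandwich by the LCU
operators themselves, with no sampling error in the mean. -/
theorem zeta_sq_mul_sum {n K : ℕ} {e : Fin K → ℕ} (ρS : QOp (Fin n))
    (ρE : ∀ j, QOp (Fin (e j))) (O : QOp (Fin n)) (D : ∀ j, LCU n (e j))
    (hw : ∀ j, (D j).weight ≠ 0) :
    ((zeta D ^ 2 : ℝ) : ℂ) * ∑ a : ∀ j, (D j).Idx, ∑ b : ∀ j, (D j).Idx,
      ((∏ j, (D j).prob (a j) * (D j).prob (b j) : ℝ) : ℂ) *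
        (sigmaXO O * finalState ρS ρE (fun j => (D j).word (a j))
          (fun j => (D j).word (b j))).trace =
      (O * crossMap ρE (fun j => (D j).op) (fun j => (D j).op) ρS).trace := by
  set c : (∀ j, (D j).Idx) → (∀ j, (D j).Idx) → ℂ := fun a b =>
    (O * crossMap ρE (fun j => wordMat ((D j).word (a j)))
      (fun j => wordMat ((D j).word (b j))) ρS).trace
  have hr : (O * crossMap ρE (fun j => (D j).op) (fun j => (D j).op) ρS).trace =
      ∑ a : ∀ j, (D j).Idx, ∑ b : ∀ j, (D j).Idx,
        ((∏ j, ((D j).coeff (a j) : ℂ)) * ∏ j, ((D j).coeff (b j) : ℂ)) * c a b := by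
    rw [crossMap_op_op]
    simp only [Finset.mul_sum, Matrix.trace_sum, Matrix.mul_smul, Matrix.trace_smul, smul_eq_mul, c]
  have hp : ∀ a b : ∀ j, (D j).Idx, ((zeta D ^ 2 : ℝ) : ℂ) *
      ((∏ j, (D j).prob (a j) * (D j).prob (b j) : ℝ) : ℂ) =
        (∏ j, ((D j).coeff (a j) : ℂ)) * ∏ j, ((D j).coeff (b j) : ℂ) := by
    intro a b
    rw [← Complex.ofReal_mul, ← Complex.ofReal_prod, ← Complex.ofReal_prod, ← Complex.ofReal_mul,
      zeta, ← Finset.prod_pow, ← Finset.prod_mul_distrib, ← Finset.prod_mul_distrib]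
    congr 1
    refine Finset.prod_congr rfl fun j _ => ?_
    rw [← (D j).weight_mul_prob (hw j), ← (D j).weight_mul_prob (hw j)]
    ring
  -- The block `(1, 0)` carries the pair `(X, Y)` and the block `(0, 1)` the pair `(Y, X)`, each
  -- with the factor `1/2` from `|+⟩⟨+|`.
  have ht : ∀ a b : ∀ j, (D j).Idx, (sigmaXO O * finalState ρS ρE (fun j => (D j).word (a j))
      (fun j => (D j).word (b j))).trace = 1 / 2 * c a b + 1 / 2 * c b a := by
    intro a b
    rw [trace_sigmaXO_mul, ancillaBlock_finalState, ancillaBlock_finalState]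
    simp [c]
  -- The two samples have the same law, so both halves have equal average.
  have hs : ∑ a : ∀ j, (D j).Idx, ∑ b : ∀ j, (D j).Idx,
        ((∏ j, ((D j).coeff (a j) : ℂ)) * ∏ j, ((D j).coeff (b j) : ℂ)) * c b a =
      ∑ a : ∀ j, (D j).Idx, ∑ b : ∀ j, (D j).Idx,
        ((∏ j, ((D j).coeff (a j) : ℂ)) * ∏ j, ((D j).coeff (b j) : ℂ)) * c a b := by
    rw [Finset.sum_comm]
    refine Finset.sum_congr rfl fun a _ => Finset.sum_congr rfl fun b _ => ?_
    ring
  simp only [Finset.mul_sum, ← mul_assoc, hp, ht, mul_add, Finset.sum_add_distrib]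
  have e1 : ∀ (z w : ℂ), z * (1 / 2) * w = 1 / 2 * (z * w) := fun z w => by ring
  simp only [e1, ← Finset.mul_sum, hs, hr]
  ring

/-! ### Gates are unitary -/

theorem Pauli.mat_isHermitian (P : Pauli) : (P.mat)ᴴ = P.mat := by
  ext i j
  cases P <;> fin_cases i <;> fin_cases j <;> simp [Pauli.mat]

theorem Pauli.mat_mul_self (P : Pauli) : P.mat * P.mat = 1 := by
  ext i j
  cases P <;> fin_cases i <;> fin_cases j <;> simp [Pauli.mat]

theorem pauliTensor_conjTranspose {ι : Type} [Fintype ι] (P : ι → Pauli) :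
    (pauliTensor P)ᴴ = pauliTensor P := by
  ext x y
  simp only [pauliTensor, Matrix.conjTranspose_apply, Matrix.of_apply, star_prod]
  refine Finset.prod_congr rfl fun i _ => ?_
  rw [← Matrix.conjTranspose_apply, Pauli.mat_isHermitian]

theorem pauliTensor_mul_self {ι : Type} [Fintype ι] [DecidableEq ι] (P : ι → Pauli) :
    pauliTensor P * pauliTensor P = 1 := by
  ext x y
  simp only [pauliTensor, Matrix.mul_apply, Matrix.of_apply, ← Finset.prod_mul_distrib]
  have h := Finset.prod_univ_sum (fun _ : ι => (Finset.univ : Finset (Fin 2)))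
    (fun i k => (P i).mat (x i) k * (P i).mat k (y i))
  rw [Fintype.piFinset_univ] at h
  rw [← h]
  simp only [← Matrix.mul_apply, Pauli.mat_mul_self]
  by_cases h : x = y
  · subst h; simp
  · obtain ⟨i, hi⟩ := Function.ne_iff.1 h
    rw [Matrix.one_apply_ne h]
    exact Finset.prod_eq_zero (Finset.mem_univ i) (Matrix.one_apply_ne hi)

theorem PauliString.mat_conjTranspose {n e : ℕ} (P : PauliString n e) : P.matᴴ = P.mat := by
  rw [PauliString.mat, Matrix.conjTranspose_smul, Matrix.conjTranspose_kronecker,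
    pauliTensor_conjTranspose, pauliTensor_conjTranspose]
  simp

theorem PauliString.mat_mul_self {n e : ℕ} (P : PauliString n e) : P.mat * P.mat = 1 := by
  rw [PauliString.mat, smul_mul_smul_comm, ← Matrix.mul_kronecker_mul, pauliTensor_mul_self,
    pauliTensor_mul_self, Matrix.one_kronecker_one]
  rcases Int.units_eq_one_or P.sign with h | h <;> simp [h]

theorem PauliString.norm_mat_le {n e : ℕ} (P : PauliString n e) : ‖P.mat‖ ≤ 1 := by
  have h := Matrix.l2_opNorm_conjTranspose_mul_self P.mat
  rw [P.mat_conjTranspose, P.mat_mul_self] at h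
  have := norm_one_le (s := (Fin n → Fin 2) × (Fin e → Fin 2))
  nlinarith [norm_nonneg P.mat]

theorem PauliGate.mat_mem_unitary {n e : ℕ} (g : PauliGate n e) : g.mat ∈ unitary (SEOp n e) := by
  have key : ∀ A : SEOp n e, star A = Aᴴ := fun A => rfl
  cases g with
  | string c P =>
    rw [Unitary.mem_iff, PauliGate.mat, key, Matrix.conjTranspose_smul, P.mat_conjTranspose,
      smul_mul_smul_comm, smul_mul_smul_comm, P.mat_mul_self]
    have : star (Complex.I ^ (c : ℕ)) * Complex.I ^ (c : ℕ) = 1 := by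
      rw [star_pow, ← mul_pow]; simp
    rw [this, mul_comm, this, one_smul]
    exact ⟨rfl, rfl⟩
  | rotation θ P =>
    have hcs : (Real.cos θ : ℂ) * Real.cos θ + (Real.sin θ : ℂ) * Real.sin θ = 1 := by
      rw [← Complex.ofReal_mul, ← Complex.ofReal_mul, ← Complex.ofReal_add, ← sq, ← sq,
        Real.cos_sq_add_sin_sq, Complex.ofReal_one]
    have hst : star ((Real.cos θ : ℂ) • (1 : SEOp n e) - (Complex.I * (Real.sin θ : ℂ)) • P.mat) =
        (Real.cos θ : ℂ) • 1 + (Complex.I * (Real.sin θ : ℂ)) • P.mat := by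
      rw [key, Matrix.conjTranspose_sub, Matrix.conjTranspose_smul, Matrix.conjTranspose_smul,
        P.mat_conjTranspose]
      simp [-Complex.ofReal_cos, -Complex.ofReal_sin, sub_eq_add_neg]
    rw [Unitary.mem_iff, PauliGate.mat, hst]
    have hI : Complex.I * (Real.sin θ : ℂ) * (Complex.I * (Real.sin θ : ℂ)) =
      -((Real.sin θ : ℂ) * Real.sin θ) := by
      linear_combination ((Real.sin θ : ℂ) * Real.sin θ) * Complex.I_mul_I
    constructor
    · rw [add_mul, mul_sub, mul_sub, smul_mul_smul_comm, smul_mul_smul_comm, smul_mul_smul_comm,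
        smul_mul_smul_comm, P.mat_mul_self, hI, mul_one, one_mul, mul_one,
        mul_comm (Complex.I * _) (Real.cos θ : ℂ), neg_smul]
      rw [sub_add_sub_cancel, sub_neg_eq_add, ← add_smul, hcs, one_smul]
    · rw [sub_mul, mul_add, mul_add, smul_mul_smul_comm, smul_mul_smul_comm, smul_mul_smul_comm,
        smul_mul_smul_comm, P.mat_mul_self, hI, mul_one, one_mul, mul_one,
        mul_comm (Complex.I * _) (Real.cos θ : ℂ), neg_smul]
      rw [← sub_sub, add_sub_cancel_right, sub_neg_eq_add, ← add_smul, hcs, one_smul]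

theorem wordMat_mem_unitary {n e : ℕ} (w : List (PauliGate n e)) :
    wordMat w ∈ unitary (SEOp n e) :=
  list_prod_map_mem_unitary _ PauliGate.mat_mem_unitary w

theorem isDensity_plusState : IsDensity plusState := by
  constructor
  · have : plusState = (1 / 2 : ℂ) • (Matrix.of fun (_ : Unit) (_ : Fin 2) => (1 : ℂ))ᴴ *
        Matrix.of fun (_ : Unit) (_ : Fin 2) => (1 : ℂ) := by
      ext i j; simp [plusState, Matrix.mul_apply]
    rw [this, Matrix.smul_mul]
    exact (Matrix.posSemidef_conjTranspose_mul_self _).smul (by positivity)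
  · simp [plusState, Matrix.trace]

theorem isDensity_finalState {n K : ℕ} {e : Fin K → ℕ} {ρS : QOp (Fin n)} (hS : IsDensity ρS)
    {ρE : ∀ j, QOp (Fin (e j))} (hE : ∀ j, IsDensity (ρE j))
    (X Y : ∀ j, List (PauliGate n (e j))) : IsDensity (finalState ρS ρE X Y) := by
  have h0 : IsDensity (plusState ⊗ₖ ρS) := isDensity_plusState.kronecker hS
  rw [finalState]
  generalize plusState ⊗ₖ ρS = σ at h0
  induction K with
  | zero => simpa using h0
  | succ K ih =>
    rw [Fin.foldl_succ_last]
    have := ih (fun j => hE j.castSucc) (fun j => X j.castSucc) (fun j => Y j.castSucc)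
    refine IsDensity.ptrace (IsDensity.conj (this.kronecker (hE _)) ?_)
    rw [collisionOp_eq]
    refine ancillaDiag_mem_unitary fun b => ?_
    fin_cases b
    · exact wordMat_mem_unitary _
    · exact wordMat_mem_unitary _



/-! ### Laws of bounded outcomes -/

/-- `ν` is a probability law on `[-B, B]` with mean `m`. -/
structure BoundedLaw (ν : Measure ℝ) (B m : ℝ) : Prop where
  prob : IsProbabilityMeasure ν
  mem_Icc : ∀ᵐ x ∂ν, x ∈ Set.Icc (-B) B
  mean : ∫ x, x ∂ν = m

theorem BoundedLaw.integrable {ν : Measure ℝ} {B m : ℝ} (h : BoundedLaw ν B m) :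
    Integrable (fun x => x) ν :=
  have := h.prob
  Integrable.of_mem_Icc (-B) B aemeasurable_id h.mem_Icc

theorem BoundedLaw.mono {ν : Measure ℝ} {B B' m : ℝ} (h : BoundedLaw ν B m) (hB : B ≤ B') :
    BoundedLaw ν B' m :=
  ⟨h.prob, h.mem_Icc.mono fun _ hx => ⟨(neg_le_neg hB).trans hx.1, hx.2.trans hB⟩, h.mean⟩

theorem BoundedLaw.dirac {B x : ℝ} (h : |x| ≤ B) : BoundedLaw (Measure.dirac x) B x where
  prob := inferInstance
  mem_Icc := by
    rw [ae_dirac_eq]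
    exact abs_le.1 h
  mean := integral_dirac _ _

theorem BoundedLaw.mixture {ι : Type} [Fintype ι] {p : ι → ℝ} (hp : ∀ i, 0 ≤ p i)
    (hp1 : ∑ i, p i = 1) {ν : ι → Measure ℝ} {B : ℝ} {m : ι → ℝ}
    (h : ∀ i, BoundedLaw (ν i) B (m i)) :
    BoundedLaw (∑ i, ENNReal.ofReal (p i) • ν i) B (∑ i, p i * m i) where
  prob := by
    constructor
    have : ∀ i, ν i Set.univ = 1 := fun i => (h i).prob.measure_univ
    rw [Measure.finsetSum_apply]
    simp only [Measure.smul_apply, this, smul_eq_mul, mul_one]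
    rw [← ENNReal.ofReal_sum_of_nonneg fun i _ => hp i, hp1, ENNReal.ofReal_one]
  mem_Icc := by
    rw [ae_iff, Measure.finsetSum_apply]
    refine Finset.sum_eq_zero fun i _ => ?_
    rw [Measure.smul_apply, ae_iff.1 (h i).mem_Icc, smul_zero]
  mean := by
    rw [integral_finsetSum_measure fun i _ => (h i).integrable.smul_measure ENNReal.ofReal_ne_top]
    refine Finset.sum_congr rfl fun i _ => ?_
    rw [integral_smul_measure, (h i).mean, ENNReal.toReal_ofReal (hp i), smul_eq_mul]

theorem abs_eigenvalues_le {s : Type} [Fintype s] [DecidableEq s] {A : Matrix s s ℂ}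
    (hA : A.IsHermitian) (i : s) : |hA.eigenvalues i| ≤ ‖A‖ := by
  have h1 : ‖A‖ = ‖(Matrix.diagonal (RCLike.ofReal ∘ hA.eigenvalues) : Matrix s s ℂ)‖ := by
    conv_lhs => rw [hA.spectral_theorem, Unitary.conjStarAlgAut_apply]
    rw [mul_assoc, CStarRing.norm_coe_unitary_mul]
    exact CStarRing.norm_mul_coe_unitary _ (star hA.eigenvectorUnitary)
  rw [h1, Matrix.l2_opNorm_diagonal]
  refine le_trans ?_ (norm_le_pi_norm _ i)
  simp

/-- In the eigenbasis of `A` the diagonal of `ρ` is a probability vector, and the Born law is the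
corresponding mixture of point masses at eigenvalues. -/
theorem boundedLaw_measureLaw {s : Type} [Fintype s] [DecidableEq s] {A : Matrix s s ℂ}
    (hA : A.IsHermitian) {ρ : Matrix s s ℂ} (hρ : IsDensity ρ) :
    ∃ m : ℝ, (m : ℂ) = (A * ρ).trace ∧ BoundedLaw (measureLaw hA ρ) ‖A‖ m := by
  set U : Matrix s s ℂ := (hA.eigenvectorUnitary : Matrix s s ℂ)
  have hpsd : (star U * ρ * U).PosSemidef := hρ.1.conjTranspose_mul_mul_same U
  have hnn : ∀ i, 0 ≤ (star U * ρ * U) i i := fun i => hpsd.diag_nonneg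
  have hre : ∀ i, (((star U * ρ * U) i i).re : ℂ) = (star U * ρ * U) i i := fun i =>
    (Complex.eq_re_of_ofReal_le (r := 0) (by exact_mod_cast hnn i)).symm
  have hUU : U * star U = 1 := Unitary.mul_star_self_of_mem hA.eigenvectorUnitary.2
  have htr : (star U * ρ * U).trace = 1 := by
    rw [Matrix.trace_mul_comm, ← mul_assoc, hUU, one_mul, hρ.2]
  refine ⟨_, ?_, BoundedLaw.mixture (fun i => ?_) ?_ fun i => BoundedLaw.dirac
    (abs_eigenvalues_le hA i)⟩
  · have hAe : A = U * Matrix.diagonal (RCLike.ofReal ∘ hA.eigenvalues) * star U := by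
      conv_lhs => rw [hA.spectral_theorem, Unitary.conjStarAlgAut_apply]
    have : (A * ρ).trace = (Matrix.diagonal (RCLike.ofReal ∘ hA.eigenvalues) *
        (star U * ρ * U)).trace := by
      conv_lhs => rw [hAe, mul_assoc, mul_assoc, Matrix.trace_mul_comm]
      simp only [mul_assoc]
    rw [this]
    simp only [Matrix.trace, Matrix.diag_apply, Matrix.diagonal_mul, Complex.ofReal_sum,
      Complex.ofReal_mul, Function.comp_apply]
    refine Finset.sum_congr rfl fun i _ => ?_
    rw [mul_comm, hre]
    rfl
  · exact (Complex.nonneg_iff.1 (hnn i)).1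
  · have := congrArg Complex.re htr
    rwa [Matrix.trace, Complex.re_sum, Complex.one_re] at this

theorem norm_sigmaXO_le {n : ℕ} (O : QOp (Fin n)) : ‖sigmaXO O‖ ≤ ‖O‖ := by
  have hX : ‖Pauli.X.mat‖ ≤ 1 := by
    have h := Matrix.l2_opNorm_conjTranspose_mul_self Pauli.X.mat
    rw [Pauli.mat_isHermitian, Pauli.mat_mul_self] at h
    have := norm_one_le (s := Fin 2)
    nlinarith [norm_nonneg Pauli.X.mat]
  have : sigmaXO O = (Pauli.X.mat ⊗ₖ 1) * (1 ⊗ₖ O) := by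
    rw [sigmaXO, ← Matrix.mul_kronecker_mul, one_mul, mul_one]
  rw [this]
  calc _ ≤ ‖Pauli.X.mat ⊗ₖ (1 : QOp (Fin n))‖ * ‖(1 : Matrix (Fin 2) (Fin 2) ℂ) ⊗ₖ O‖ :=
        Matrix.l2_opNorm_mul _ _
    _ ≤ 1 * ‖O‖ := mul_le_mul ((norm_kronecker_one_le _).trans hX) (norm_one_kronecker_le O)
        (norm_nonneg _) zero_le_one
    _ = ‖O‖ := one_mul _

theorem LCU.weight_nonneg {n e : ℕ} (D : LCU n e) : 0 ≤ D.weight :=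
  Finset.sum_nonneg fun k _ => D.coeff_nonneg k

theorem LCU.prob_nonneg {n e : ℕ} (D : LCU n e) (k : D.Idx) : 0 ≤ D.prob k :=
  div_nonneg (D.coeff_nonneg k) D.weight_nonneg

theorem LCU.sum_prob {n e : ℕ} (D : LCU n e) (h : D.weight ≠ 0) : ∑ k, D.prob k = 1 := by
  simp only [LCU.prob, ← Finset.sum_div]
  exact div_self h

theorem boundedLaw_runLaw {n K : ℕ} {e : Fin K → ℕ} {ρS : QOp (Fin n)} (hS : IsDensity ρS)
    {ρE : ∀ j, QOp (Fin (e j))} (hE : ∀ j, IsDensity (ρE j)) {O : QOp (Fin n)}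
    (hO : O.IsHermitian) (D : ∀ j, LCU n (e j)) (hw : ∀ j, (D j).weight ≠ 0) :
    ∃ m : ℝ, ((zeta D ^ 2 * m : ℝ) : ℂ) =
        (O * crossMap ρE (fun j => (D j).op) (fun j => (D j).op) ρS).trace ∧
      BoundedLaw (runLaw ρS ρE hO D) ‖O‖ m := by
  choose m hm hl using fun ab : (∀ j, (D j).Idx) × (∀ j, (D j).Idx) =>
    boundedLaw_measureLaw (sigmaXO_isHermitian hO) (isDensity_finalState hS hE
      (fun j => (D j).word (ab.1 j)) (fun j => (D j).word (ab.2 j)))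
  refine ⟨∑ ab : (∀ j, (D j).Idx) × (∀ j, (D j).Idx),
    (∏ j, (D j).prob (ab.1 j) * (D j).prob (ab.2 j)) * m ab, ?_, ?_⟩
  · rw [← zeta_sq_mul_sum ρS ρE O D hw, Complex.ofReal_mul, Complex.ofReal_sum,
      Fintype.sum_prod_type]
    simp only [Complex.ofReal_mul, hm]
  · have : runLaw ρS ρE hO D = ∑ ab : (∀ j, (D j).Idx) × (∀ j, (D j).Idx),
        ENNReal.ofReal (∏ j, (D j).prob (ab.1 j) * (D j).prob (ab.2 j)) •
          measureLaw (sigmaXO_isHermitian hO) (finalState ρS ρE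
            (fun j => (D j).word (ab.1 j)) (fun j => (D j).word (ab.2 j))) := by
      rw [Fintype.sum_prod_type]; rfl
    rw [this]
    refine BoundedLaw.mixture (fun ab => ?_) ?_ fun ab => (hl ab).mono (norm_sigmaXO_le O)
    · exact Finset.prod_nonneg fun j _ =>
        mul_nonneg ((D j).prob_nonneg _) ((D j).prob_nonneg _)
    · have h1 : ∑ a : ∀ j, (D j).Idx, ∏ j, (D j).prob (a j) = 1 := by
        have h := Finset.prod_univ_sum (fun j => (Finset.univ : Finset (D j).Idx))
          (fun j k => (D j).prob k)
        rw [Fintype.piFinset_univ] at h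
        rw [← h]
        exact Finset.prod_eq_one fun j _ => (D j).sum_prob (hw j)
      rw [Fintype.sum_prod_type]
      simp only [Finset.prod_mul_distrib, ← Finset.mul_sum, h1, mul_one]

/-! ### Concentration of the empirical mean -/

theorem BoundedLaw.ae_pi {ν : Measure ℝ} {B m : ℝ} (h : BoundedLaw ν B m) (T : ℕ) :
    ∀ᵐ x ∂Measure.pi (fun _ : Fin T => ν), ∀ i, x i ∈ Set.Icc (-B) B := by
  have := h.prob
  rw [ae_all_iff]
  intro i
  exact (measurePreserving_eval (fun _ : Fin T => ν) i).quasiMeasurePreserving.ae h.mem_Icc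

theorem BoundedLaw.hoeffding {ν : Measure ℝ} {B m : ℝ} (h : BoundedLaw ν B m) (T : ℕ) {t : ℝ}
    (ht : 0 ≤ t) :
    (Measure.pi (fun _ : Fin T => ν)).real {x | t ≤ |∑ i, x i - T * m|} ≤
      2 * Real.exp (-t ^ 2 / (2 * (T * B ^ 2))) := by
  have := h.prob
  set P := Measure.pi (fun _ : Fin T => ν)
  have hmp : ∀ i, MeasurePreserving (Function.eval i) P ν :=
    fun i => measurePreserving_eval (fun _ : Fin T => ν) i
  have hmean : ∀ i, ∫ x, x i ∂P = m := fun i => by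
    rw [← h.mean, ← (hmp i).map_eq, integral_map (f := fun x => x)
      (hmp i).measurable.aemeasurable aestronglyMeasurable_id]
  -- Hoeffding's lemma: the parameter is the squared half-length of `[-B, B]`, that is `B ^ 2`.
  have hsub : ∀ i, HasSubgaussianMGF (fun x : Fin T → ℝ => x i - m) ((‖B - (-B)‖₊ / 2) ^ 2) P := by
    intro i
    have := hasSubgaussianMGF_of_mem_Icc (μ := P) (X := fun x => x i) (a := -B) (b := B)
      (hmp i).measurable.aemeasurable ((h.ae_pi T).mono fun x hx => hx i)
    rwa [hmean i] at this
  have hind : iIndepFun (fun i (x : Fin T → ℝ) => x i - m) P :=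
    iIndepFun_pi (X := fun _ x => x - m) fun i => (measurable_id.sub_const m).aemeasurable
  have hind' : iIndepFun (fun i (x : Fin T → ℝ) => -(x i - m)) P :=
    iIndepFun_pi (X := fun _ x => -(x - m)) fun i => (measurable_id.sub_const m).neg.aemeasurable
  have hc : ((∑ _i : Fin T, (‖B - (-B)‖₊ / 2) ^ 2 : NNReal) : ℝ) = T * B ^ 2 := by
    simp only [Finset.sum_const, Finset.card_univ, Fintype.card_fin, nsmul_eq_mul]
    push_cast
    rw [sub_neg_eq_add, ← two_mul, norm_mul, Real.norm_ofNat, mul_div_cancel_left₀ _ two_ne_zero,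
      Real.norm_eq_abs, sq_abs]
  have hs : ∀ x : Fin T → ℝ, ∑ i, (x i - m) = ∑ i, x i - T * m := fun x => by
    simp [Finset.sum_sub_distrib]
  have h1 := HasSubgaussianMGF.measure_sum_ge_le_of_iIndepFun hind
    (s := Finset.univ) (fun i _ => hsub i) ht
  have h2 := HasSubgaussianMGF.measure_sum_ge_le_of_iIndepFun hind'
    (s := Finset.univ) (fun i _ => (hsub i).neg) ht
  rw [hc] at h1 h2
  simp only [Finset.sum_neg_distrib, hs] at h1 h2
  calc _ ≤ P.real ({x | t ≤ ∑ i, x i - T * m} ∪ {x | t ≤ -(∑ i, x i - T * m)}) :=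
        measureReal_mono fun x (hx : t ≤ |∑ i, x i - T * m|) => le_abs.1 hx
    _ ≤ _ := measureReal_union_le _ _
    _ ≤ _ := by linarith

theorem measurableSet_estimate (ζ : ℝ) (v : ℂ) (ε : ℝ) (T : ℕ) :
    MeasurableSet {x : Fin T → ℝ | ‖((estimate ζ x : ℝ) : ℂ) - v‖ ≤ ε} := by
  apply measurableSet_le _ measurable_const
  unfold estimate
  fun_prop

/-- Half of `ε` pays for the bias. The other half, rescaled by `ζ ^ 2 / T`, is the deviation `t` of
the sum; it makes the Hoeffding exponent `-T ε² / (8 ‖O‖² ζ⁴)`. -/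
theorem succeeds_of_bias {n K : ℕ} {e : Fin K → ℕ} {ρS : QOp (Fin n)}
    {ρE : ∀ j, QOp (Fin (e j))} {O : QOp (Fin n)} {hO : O.IsHermitian} {D : ∀ j, LCU n (e j)}
    (hζ : 0 < zeta D) (hO0 : 0 < ‖O‖) {m : ℝ} (hm : BoundedLaw (runLaw ρS ρE hO D) ‖O‖ m)
    {v : ℂ} {ε δ : ℝ} (hε : 0 < ε) (hδ : 0 < δ) (hδ1 : δ < 1)
    (hb : ‖((zeta D ^ 2 * m : ℝ) : ℂ) - v‖ ≤ ε / 2) {T : ℕ}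
    (hT : 8 * ‖O‖ ^ 2 * Real.log (2 / δ) * zeta D ^ 4 / ε ^ 2 ≤ T) :
    Succeeds ρS ρE hO D T v ε δ := by
  have := hm.prob
  have hlog : 0 < Real.log (2 / δ) := Real.log_pos (by rw [lt_div_iff₀ hδ]; linarith)
  have hT0 : (0 : ℝ) < T := lt_of_lt_of_le (by positivity) hT
  set ζ := zeta D
  set t : ℝ := T * ε / (2 * ζ ^ 2)
  have hH := hm.hoeffding T (t := t) (by positivity)
  set P := Measure.pi (fun _ : Fin T => runLaw ρS ρE hO D)
  have hexp : 2 * Real.exp (-t ^ 2 / (2 * (T * ‖O‖ ^ 2))) ≤ δ := by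
    have h1 : -t ^ 2 / (2 * (T * ‖O‖ ^ 2)) ≤ -Real.log (2 / δ) := by
      have : -t ^ 2 / (2 * (T * ‖O‖ ^ 2)) = -(T * ε ^ 2 / (8 * ‖O‖ ^ 2 * ζ ^ 4)) := by
        simp only [t]; field_simp; ring
      rw [this, neg_le_neg_iff, le_div_iff₀ (by positivity)]
      rw [div_le_iff₀ (by positivity)] at hT
      linarith
    have h2 := Real.exp_le_exp.2 h1
    rw [Real.exp_neg, Real.exp_log (by positivity), inv_div] at h2
    linarith
  have hsub : {x : Fin T → ℝ | ‖((estimate ζ x : ℝ) : ℂ) - v‖ ≤ ε}ᶜ ⊆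
      {x | t ≤ |∑ i, x i - T * m|} := by
    intro x hx
    simp only [Set.mem_compl_iff, Set.mem_ofPred_eq, not_le] at hx ⊢
    have h1 : ‖((estimate ζ x : ℝ) : ℂ) - v‖ ≤
        ‖((estimate ζ x - ζ ^ 2 * m : ℝ) : ℂ)‖ + ‖((ζ ^ 2 * m : ℝ) : ℂ) - v‖ := by
      refine le_trans (le_of_eq ?_) (norm_add_le _ _)
      congr 1
      push_cast
      ring
    have h2 : estimate ζ x - ζ ^ 2 * m = ζ ^ 2 / T * (∑ i, x i - T * m) := by
      unfold estimate; field_simp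
    rw [Complex.norm_real, h2, norm_mul, Real.norm_of_nonneg (by positivity : 0 ≤ ζ ^ 2 / T),
      Real.norm_eq_abs] at h1
    have h3 : ε / 2 ≤ ζ ^ 2 / T * |∑ i, x i - T * m| := by linarith
    calc t = ε / 2 / (ζ ^ 2 / T) := by simp only [t]; field_simp
      _ ≤ _ := by rw [div_le_iff₀ (by positivity)]; linarith
  have hc : P.real {x : Fin T → ℝ | ‖((estimate ζ x : ℝ) : ℂ) - v‖ ≤ ε}ᶜ ≤ δ :=
    (measureReal_mono hsub).trans (hH.trans hexp)
  rw [probReal_compl_eq_one_sub (measurableSet_estimate ζ v ε T)] at hc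
  unfold Succeeds
  rw [← ENNReal.ofReal_toReal (measure_ne_top _ _)]
  apply ENNReal.ofReal_le_ofReal
  change 1 - δ ≤ P.real _
  linarith

/-- The regime of large `ε`: the estimate is almost surely at most `ζ ^ 2 * ‖O‖` in modulus,
whatever the number of runs. -/
theorem succeeds_of_bound {n K : ℕ} {e : Fin K → ℕ} {ρS : QOp (Fin n)}
    {ρE : ∀ j, QOp (Fin (e j))} {O : QOp (Fin n)} {hO : O.IsHermitian} {D : ∀ j, LCU n (e j)}
    {m : ℝ} (hm : BoundedLaw (runLaw ρS ρE hO D) ‖O‖ m)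
    {v : ℂ} {ε δ : ℝ} (hδ : 0 < δ) (h : zeta D ^ 2 * ‖O‖ + ‖v‖ ≤ ε) (T : ℕ) :
    Succeeds ρS ρE hO D T v ε δ := by
  have := hm.prob
  unfold Succeeds
  have hae : ∀ᵐ x ∂Measure.pi (fun _ : Fin T => runLaw ρS ρE hO D),
      x ∈ {x : Fin T → ℝ | ‖((estimate (zeta D) x : ℝ) : ℂ) - v‖ ≤ ε} := by
    refine (hm.ae_pi T).mono fun x hx => ?_
    refine (norm_sub_le _ _).trans (le_trans (add_le_add_left ?_ _) h)
    rw [Complex.norm_real, estimate, norm_mul, Real.norm_of_nonneg (by positivity)]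
    have h1 : ‖∑ i, x i‖ ≤ T * ‖O‖ := by
      refine (norm_sum_le _ _).trans ?_
      calc _ ≤ ∑ _i : Fin T, ‖O‖ := Finset.sum_le_sum fun i _ => abs_le.2 (hx i)
        _ = _ := by simp
    -- With no runs the estimate is `0`, as the sum is empty.
    rcases Nat.eq_zero_or_pos T with rfl | hT
    · simp; positivity
    · have hT' : (0 : ℝ) < T := by exact_mod_cast hT
      calc _ ≤ zeta D ^ 2 / T * (T * ‖O‖) := by gcongr
        _ = _ := by field_simp
  rw [(mem_ae_iff_prob_eq_one (measurableSet_estimate (zeta D) v ε T)).1 hae]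
  exact ENNReal.ofReal_le_one.2 (by linarith)


/-! ### Truncations of the exponential series -/

/-- Since `N! k! ≤ (N + k)!`, the tail is dominated by `x ^ N / N!` times the whole series. -/
theorem norm_exp_sub_sum_le {R : Type} [NormedRing R] [NormedAlgebra ℂ R] [CompleteSpace R]
    [NormOneClass R] {A : R} {x : ℝ} (hA : ‖A‖ ≤ x) (N : ℕ) :
    ‖NormedSpace.exp A - ∑ k ∈ Finset.range N, ((k.factorial : ℂ)⁻¹) • A ^ k‖ ≤
      x ^ N / N.factorial * Real.exp x := by
  have hx : 0 ≤ x := (norm_nonneg A).trans hA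
  have h0 : HasSum (fun k : ℕ => ((k.factorial : ℂ)⁻¹) • A ^ k) (NormedSpace.exp A) :=
    NormedSpace.exp_series_hasSum_exp' A
  have h1 := (hasSum_nat_add_iff' N).2 h0
  have h2 : HasSum (fun k : ℕ => x ^ N / N.factorial * (x ^ k / k.factorial))
      (x ^ N / N.factorial * Real.exp x) := by
    refine HasSum.mul_left _ ?_
    rw [Real.exp_eq_exp_ℝ]
    exact NormedSpace.expSeries_div_hasSum_exp x
  rw [← h1.tsum_eq]
  refine tsum_of_norm_bounded h2 fun k => ?_
  have hf : ((N.factorial * k.factorial : ℕ) : ℝ) ≤ ((k + N).factorial : ℕ) := by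
    rw [add_comm]
    exact_mod_cast Nat.le_of_dvd (Nat.factorial_pos _) (Nat.factorial_mul_factorial_dvd_factorial_add N k)
  push_cast at hf
  have hfN : (0 : ℝ) < N.factorial := by exact_mod_cast N.factorial_pos
  have hfk : (0 : ℝ) < k.factorial := by exact_mod_cast k.factorial_pos
  rw [norm_smul, norm_inv, Complex.norm_natCast]
  calc _ ≤ ((k + N).factorial : ℝ)⁻¹ * x ^ (k + N) := by
        gcongr
        exact (norm_pow_le A _).trans (by gcongr)
    _ ≤ (N.factorial * k.factorial : ℝ)⁻¹ * x ^ (k + N) := by gcongr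
    _ = _ := by rw [pow_add]; field_simp

theorem norm_pow_sub_pow_le {R : Type} [NormedRing R] [NormOneClass R] {a b : R} {c : ℝ}
    (hc : 1 ≤ c) (ha : ‖a‖ ≤ c) (hb : ‖b‖ ≤ c) (r : ℕ) :
    ‖a ^ r - b ^ r‖ ≤ r * c ^ r * ‖a - b‖ := by
  induction r with
  | zero => simp
  | succ r ih =>
    have e : a ^ (r + 1) - b ^ (r + 1) = a ^ r * (a - b) + (a ^ r - b ^ r) * b := by
      rw [pow_succ, pow_succ]; noncomm_ring
    have h1 : ‖a ^ r * (a - b)‖ ≤ c ^ (r + 1) * ‖a - b‖ := by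
      refine (norm_mul_le _ _).trans (mul_le_mul_of_nonneg_right ?_ (norm_nonneg _))
      calc _ ≤ ‖a‖ ^ r := norm_pow_le a r
        _ ≤ c ^ r := by gcongr
        _ ≤ c ^ (r + 1) := pow_le_pow_right₀ hc r.le_succ
    have h2 : ‖(a ^ r - b ^ r) * b‖ ≤ r * c ^ r * ‖a - b‖ * c :=
      (norm_mul_le _ _).trans (mul_le_mul ih hb (norm_nonneg _) (by positivity))
    rw [e]
    refine (norm_add_le _ _).trans ((add_le_add h1 h2).trans (le_of_eq ?_))
    push_cast
    ring

theorem sum_range_two_mul {E : Type} [AddCommMonoid E] (f : ℕ → E) (N : ℕ) :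
    ∑ k ∈ Finset.range (2 * N), f k = ∑ t ∈ Finset.range N, (f (2 * t) + f (2 * t + 1)) := by
  induction N with
  | zero => simp
  | succ N ih =>
    rw [Finset.sum_range_succ, ← ih, mul_add, mul_one, Finset.sum_range_succ,
      Finset.sum_range_succ, add_assoc]

/-- Each factor is at most `exp (x ^ 2 / 2)`. The quadratic exponent is what lets `r` of order
`β²Δt²K` keep `ζ` bounded. -/
theorem sqrt_one_add_mul_cosh_le (x : ℝ) : Real.sqrt (1 + x ^ 2) * Real.cosh x ≤ Real.exp (x ^ 2) := by
  have h1 : Real.sqrt (1 + x ^ 2) ≤ Real.exp (x ^ 2 / 2) := by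
    rw [Real.sqrt_le_left (Real.exp_pos _).le, ← Real.exp_nat_mul]
    have := Real.add_one_le_exp (x ^ 2)
    calc _ ≤ Real.exp (x ^ 2) := by linarith
      _ = _ := by congr 1; push_cast; ring
  calc _ ≤ Real.exp (x ^ 2 / 2) * Real.exp (x ^ 2 / 2) :=
        mul_le_mul h1 (Real.cosh_le_exp_half_sq x) (Real.cosh_pos x).le (Real.exp_pos _).le
    _ = _ := by rw [← Real.exp_add, add_halves]

theorem cos_arccos_inv_sqrt (y : ℝ) :
    Real.cos (Real.arccos (Real.sqrt (1 + y ^ 2))⁻¹) = (Real.sqrt (1 + y ^ 2))⁻¹ := by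
  have h : 1 ≤ Real.sqrt (1 + y ^ 2) := Real.one_le_sqrt.2 (by nlinarith [sq_nonneg y])
  exact Real.cos_arccos (by linarith [inv_nonneg.2 (zero_le_one.trans h)]) (inv_le_one_of_one_le₀ h)

theorem sin_arccos_inv_sqrt {y : ℝ} (hy : 0 ≤ y) :
    Real.sin (Real.arccos (Real.sqrt (1 + y ^ 2))⁻¹) = y * (Real.sqrt (1 + y ^ 2))⁻¹ := by
  have h : 0 < 1 + y ^ 2 := by positivity
  rw [Real.sin_arccos, inv_pow, Real.sq_sqrt h.le, ← Real.sqrt_inv,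
    show 1 - (1 + y ^ 2)⁻¹ = y ^ 2 * (1 + y ^ 2)⁻¹ by field_simp; ring,
    Real.sqrt_mul (sq_nonneg y), Real.sqrt_sq hy]

theorem wordMat_append {n e : ℕ} (w w' : List (PauliGate n e)) :
    wordMat (w ++ w') = wordMat w * wordMat w' := by
  simp [wordMat]

theorem wordMat_flatten_ofFn {n e r : ℕ} (w : Fin r → List (PauliGate n e)) :
    wordMat (List.ofFn w).flatten = (List.ofFn fun s => wordMat (w s)).prod := by
  rw [wordMat, List.map_flatten, List.prod_flatten, List.map_map, List.map_ofFn]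
  rfl

theorem norm_wordMat {n e : ℕ} (w : List (PauliGate n e)) : ‖wordMat w‖ = 1 :=
  CStarRing.norm_of_mem_unitary (wordMat_mem_unitary w)

namespace Model

variable {n K : ℕ} (M : Model n K) (j : Fin K)

/-! ### The segments of the truncated Taylor series -/

theorem weight_pos : 0 < M.weight j := by
  have : Nonempty (Fin (M.L j)) := ⟨⟨0, M.L_pos j⟩⟩
  exact Finset.sum_pos (fun i _ => M.h_pos j i) Finset.univ_nonempty

theorem sum_h_div_weight : ∑ i, M.h j i / M.weight j = 1 := by
  rw [← Finset.sum_div]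
  exact div_self (M.weight_pos j).ne'

/-- The normalised generator `-i H_j / β_j`. -/
def generator : SEOp n (M.e j) :=
  ∑ i, ((M.h j i / M.weight j : ℝ) : ℂ) • (Complex.I ^ 3 • (M.P j i).mat)

theorem norm_generator_le : ‖M.generator j‖ ≤ 1 := by
  rw [← M.sum_h_div_weight j]
  refine (norm_sum_le _ _).trans (Finset.sum_le_sum fun i _ => ?_)
  have h0 : 0 ≤ M.h j i / M.weight j := div_nonneg (M.h_pos j i).le (M.weight_pos j).le
  rw [norm_smul, norm_smul, Complex.norm_real, Real.norm_of_nonneg h0]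
  simpa using mul_le_mul_of_nonneg_left (M.P j i).norm_mat_le h0

theorem generator_mem_skewAdjoint : M.generator j ∈ skewAdjoint (SEOp n (M.e j)) := by
  refine sum_mem fun i _ => ?_
  rw [skewAdjoint.mem_iff, Matrix.star_eq_conjTranspose, Matrix.conjTranspose_smul,
    Matrix.conjTranspose_smul, PauliString.mat_conjTranspose, Complex.star_def, Complex.conj_ofReal,
    ← smul_neg, ← neg_smul]
  congr 2
  simp

/-- The length `x = β_j Δt / r` of a segment. -/
def segLength (r : ℕ) : ℝ := M.weight j * M.Δt / r

theorem segLength_nonneg (r : ℕ) : 0 ≤ M.segLength j r :=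
  div_nonneg (mul_nonneg (M.weight_pos j).le M.Δt_pos.le) (Nat.cast_nonneg r)

theorem unitary_eq {r : ℕ} (hr : 1 ≤ r) :
    M.unitary j = NormedSpace.exp ((M.segLength j r : ℂ) • M.generator j) ^ r := by
  rw [← Matrix.exp_nsmul, unitary]
  congr 1
  rw [ham, generator, Finset.smul_sum, Finset.smul_sum, Finset.smul_sum]
  refine Finset.sum_congr rfl fun i _ => ?_
  rw [← Nat.cast_smul_eq_nsmul ℂ, smul_smul, smul_smul, smul_smul, smul_smul]
  congr 1
  have hw : (M.weight j : ℂ) ≠ 0 := by exact_mod_cast (M.weight_pos j).ne'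
  have hr' : (r : ℂ) ≠ 0 := by exact_mod_cast (by omega : r ≠ 0)
  rw [Complex.I_pow_three, segLength]
  push_cast
  field_simp

theorem exp_mem_unitary (x : ℝ) :
    NormedSpace.exp ((x : ℂ) • M.generator j) ∈ _root_.unitary (SEOp n (M.e j)) := by
  let _ : NormedAlgebra ℚ (SEOp n (M.e j)) := NormedAlgebra.restrictScalars ℚ ℂ _
  refine NormedSpace.exp_mem_unitary_of_mem_skewAdjoint ?_
  have := M.generator_mem_skewAdjoint j
  rw [skewAdjoint.mem_iff] at this ⊢
  rw [star_smul, this, Complex.star_def, Complex.conj_ofReal, smul_neg]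

theorem norm_unitary : ‖M.unitary j‖ = 1 := by
  rw [M.unitary_eq j le_rfl, pow_one]
  exact CStarRing.norm_of_mem_unitary (M.exp_mem_unitary j _)

/-- Here `cos θ = 1 / √(1 + y²)` and `sin θ = y / √(1 + y²)`, so each rescaled rotation is `1 - i y
P`; the weights `h / β_j` sum to one. -/
theorem sum_rotation {y : ℝ} (hy : 0 ≤ y) :
    ∑ m, ((Real.sqrt (1 + y ^ 2) * (M.h j m / M.weight j) : ℝ) : ℂ) •
      (PauliGate.rotation (Real.arccos (Real.sqrt (1 + y ^ 2))⁻¹) (M.P j m)).mat =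
      1 + (y : ℂ) • M.generator j := by
  have hs : Real.sqrt (1 + y ^ 2) ≠ 0 := (Real.sqrt_pos.2 (by positivity)).ne'
  have hs' : ((Real.sqrt (1 + y ^ 2) : ℝ) : ℂ) ≠ 0 := by exact_mod_cast hs
  have hterm : ∀ m, ((Real.sqrt (1 + y ^ 2) * (M.h j m / M.weight j) : ℝ) : ℂ) •
      (PauliGate.rotation (Real.arccos (Real.sqrt (1 + y ^ 2))⁻¹) (M.P j m)).mat =
      ((M.h j m / M.weight j : ℝ) : ℂ) • 1 + (y : ℂ) •
        (((M.h j m / M.weight j : ℝ) : ℂ) • (Complex.I ^ 3 • (M.P j m).mat)) := by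
    intro m
    rw [PauliGate.mat, cos_arccos_inv_sqrt, sin_arccos_inv_sqrt hy, smul_sub, smul_smul, smul_smul,
      smul_smul, smul_smul, sub_eq_add_neg, ← neg_smul]
    congr 2
    · push_cast; field_simp
    · rw [Complex.I_pow_three]; push_cast; field_simp
  simp only [hterm, Finset.sum_add_distrib, ← Finset.sum_smul, ← Finset.smul_sum,
    ← Complex.ofReal_sum]
  rw [M.sum_h_div_weight, Complex.ofReal_one, one_smul, generator]

/-- The string part of order `k = 2t` sums to the `k`-th power of the generator, and the rotation
adds order `k + 1`. So the Taylor polynomial has degree `2 * (q / 2) + 1`, which is `q + 1` for even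
`q`. -/
theorem sum_segment (r q : ℕ) :
    ∑ a : M.SegIdx j q, (M.segCoeff j r q a : ℂ) • wordMat (M.segWord j r q a) =
      ∑ k ∈ Finset.range (2 * (q / 2 + 1)),
        ((k.factorial : ℂ)⁻¹) • ((M.segLength j r : ℂ) • M.generator j) ^ k := by
  rw [sum_range_two_mul, Finset.sum_range, Fintype.sum_sigma]
  refine Finset.sum_congr rfl fun t _ => ?_
  set k := 2 * (t : ℕ)
  set x := M.segLength j r
  have hy : 0 ≤ M.segAngle j r k := div_nonneg (M.segLength_nonneg j r) (by positivity)
  have hterm : ∀ (l : Fin k → Fin (M.L j)) (m : Fin (M.L j)),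
      (M.segCoeff j r q ⟨t, l, m⟩ : ℂ) • wordMat (M.segWord j r q ⟨t, l, m⟩) =
        ((x ^ k / k.factorial : ℝ) : ℂ) •
          (((∏ i, ((M.h j (l i) / M.weight j : ℝ) : ℂ)) •
            (List.ofFn fun i => Complex.I ^ 3 • (M.P j (l i)).mat).prod) *
          (((Real.sqrt (1 + M.segAngle j r k ^ 2) * (M.h j m / M.weight j) : ℝ) : ℂ) •
            (PauliGate.rotation (Real.arccos (Real.sqrt (1 + M.segAngle j r k ^ 2))⁻¹)
              (M.P j m)).mat)) := by
    intro l m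
    have hw : wordMat (M.segWord j r q ⟨t, l, m⟩) =
        (List.ofFn fun i => Complex.I ^ 3 • (M.P j (l i)).mat).prod *
          (PauliGate.rotation (Real.arccos (Real.sqrt (1 + M.segAngle j r k ^ 2))⁻¹)
              (M.P j m)).mat := by
      rw [segWord, wordMat_append]
      simp only [wordMat, List.map_ofFn, List.map_cons, List.map_nil, List.prod_cons,
        List.prod_nil, mul_one]
      rfl
    rw [hw, smul_mul_smul_comm, smul_smul, ← Complex.ofReal_prod, ← Complex.ofReal_mul,
      ← Complex.ofReal_mul]
    congr 2
    simp only [segCoeff, x, k, segLength]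
    ring
  rw [Fintype.sum_prod_type]
  simp only [hterm, ← Finset.smul_sum, ← Finset.mul_sum, ← Finset.sum_mul]
  rw [M.sum_rotation j hy, ← pow_sum_smul (fun i => ((M.h j i / M.weight j : ℝ) : ℂ))
    (fun i => Complex.I ^ 3 • (M.P j i).mat) k]
  have hyx : M.segAngle j r k = x / (k + 1) := rfl
  change _ • (M.generator j ^ k * (1 + _ • M.generator j)) =
    ((k.factorial : ℂ)⁻¹) • ((x : ℂ) • M.generator j) ^ k +
      (((k + 1).factorial : ℂ)⁻¹) • ((x : ℂ) • M.generator j) ^ (k + 1)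
  clear hterm
  clear_value k x
  rw [mul_add, mul_one, smul_add, Matrix.mul_smul, ← pow_succ, smul_smul, smul_pow, smul_pow,
    smul_smul, smul_smul]
  have hk : (k.factorial : ℂ) ≠ 0 := by exact_mod_cast k.factorial_ne_zero
  have hk1 : (k : ℂ) + 1 ≠ 0 := by exact_mod_cast k.succ_ne_zero
  congr 2
  · push_cast
    rw [div_eq_inv_mul]
  · rw [hyx, Nat.factorial_succ]
    push_cast
    field_simp
    ring

theorem sum_segCoeff (r q : ℕ) :
    ∑ a : M.SegIdx j q, M.segCoeff j r q a =
      ∑ t : Fin (q / 2 + 1), M.segLength j r ^ (2 * (t : ℕ)) / (2 * (t : ℕ)).factorial *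
        Real.sqrt (1 + M.segAngle j r (2 * (t : ℕ)) ^ 2) := by
  rw [Fintype.sum_sigma]
  refine Finset.sum_congr rfl fun t _ => ?_
  have h1 : ∑ l : Fin (2 * (t : ℕ)) → Fin (M.L j), ∏ i, M.h j (l i) / M.weight j = 1 := by
    have h := Fintype.sum_pow (fun i => M.h j i / M.weight j) (2 * (t : ℕ))
    rw [← h, M.sum_h_div_weight, one_pow]
  have hterm : ∀ (l : Fin (2 * (t : ℕ)) → Fin (M.L j)) (m : Fin (M.L j)),
      M.segCoeff j r q ⟨t, l, m⟩ = M.segLength j r ^ (2 * (t : ℕ)) / (2 * (t : ℕ)).factorial *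
        Real.sqrt (1 + M.segAngle j r (2 * (t : ℕ)) ^ 2) * (∏ i, M.h j (l i) / M.weight j) *
          (M.h j m / M.weight j) := fun _ _ => rfl
  rw [Fintype.sum_prod_type]
  simp only [hterm, ← Finset.mul_sum, h1, M.sum_h_div_weight, mul_one]

theorem one_le_sum_segCoeff (r q : ℕ) : 1 ≤ ∑ a : M.SegIdx j q, M.segCoeff j r q a := by
  rw [sum_segCoeff]
  have h0 : ∀ t ∈ (Finset.univ : Finset (Fin (q / 2 + 1))),
      0 ≤ M.segLength j r ^ (2 * (t : ℕ)) / (2 * (t : ℕ)).factorial *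
        Real.sqrt (1 + M.segAngle j r (2 * (t : ℕ)) ^ 2) := fun t _ => by
    have := M.segLength_nonneg j r
    positivity
  refine le_trans ?_ (Finset.single_le_sum h0 (Finset.mem_univ 0))
  simp [Real.one_le_sqrt, sq_nonneg]

theorem sum_segCoeff_le (r q : ℕ) :
    ∑ a : M.SegIdx j q, M.segCoeff j r q a ≤ Real.exp (M.segLength j r ^ 2) := by
  rw [sum_segCoeff]
  set x := M.segLength j r
  have hx : 0 ≤ x := M.segLength_nonneg j r
  calc _ ≤ ∑ t : Fin (q / 2 + 1), x ^ (2 * (t : ℕ)) / (2 * (t : ℕ)).factorial *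
        Real.sqrt (1 + x ^ 2) := by
        refine Finset.sum_le_sum fun t _ => ?_
        have h1 : M.segAngle j r (2 * (t : ℕ)) ≤ x := by
          refine div_le_self hx ?_
          have : (0 : ℝ) ≤ ((2 * (t : ℕ) : ℕ) : ℝ) := Nat.cast_nonneg _
          linarith
        have h0 : 0 ≤ M.segAngle j r (2 * (t : ℕ)) :=
          div_nonneg (M.segLength_nonneg j r) (by positivity)
        gcongr
    _ = Real.sqrt (1 + x ^ 2) *
        ∑ t ∈ Finset.range (q / 2 + 1), x ^ (2 * t) / (2 * t).factorial := by
        rw [← Finset.sum_mul, mul_comm, Finset.sum_range]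
    _ ≤ Real.sqrt (1 + x ^ 2) * Real.cosh x := by
        refine mul_le_mul_of_nonneg_left ?_ (Real.sqrt_nonneg _)
        exact sum_le_hasSum _ (fun t _ => by positivity) (Real.hasSum_cosh x)
    _ ≤ _ := sqrt_one_add_mul_cosh_le x

theorem weight_taylorLCU (r q : ℕ) :
    (M.taylorLCU r q j).weight = (∑ a : M.SegIdx j q, M.segCoeff j r q a) ^ r := by
  rw [Fintype.sum_pow]; rfl

theorem weight_taylorLCU_pos (r q : ℕ) : 0 < (M.taylorLCU r q j).weight := by
  rw [weight_taylorLCU]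
  exact pow_pos (zero_lt_one.trans_le (M.one_le_sum_segCoeff j r q)) r

theorem weight_taylorLCU_le (r q : ℕ) :
    (M.taylorLCU r q j).weight ≤ Real.exp (M.segLength j r ^ 2) ^ r := by
  rw [weight_taylorLCU]
  exact pow_le_pow_left₀ (zero_le_one.trans (M.one_le_sum_segCoeff j r q))
    (M.sum_segCoeff_le j r q) r

theorem op_taylorLCU (r q : ℕ) :
    (M.taylorLCU r q j).op =
      (∑ a : M.SegIdx j q, (M.segCoeff j r q a : ℂ) • wordMat (M.segWord j r q a)) ^ r := by
  rw [pow_sum_smul]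
  refine Finset.sum_congr rfl fun a _ => ?_
  change ((∏ s, M.segCoeff j r q (a s) : ℝ) : ℂ) •
    wordMat (List.ofFn fun s => M.segWord j r q (a s)).flatten = _
  rw [Complex.ofReal_prod, wordMat_flatten_ofFn]

/-- The exact segment is unitary and the norm of the truncated one is at most its LCU weight, so
`exp (x ^ 2)` bounds both in the comparison of `r`-th powers. -/
theorem norm_unitary_sub_taylorLCU_le {r : ℕ} (hr : 1 ≤ r) (q : ℕ) :
    ‖M.unitary j - (M.taylorLCU r q j).op‖ ≤ r * Real.exp (M.segLength j r ^ 2) ^ r *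
      (M.segLength j r ^ (2 * (q / 2 + 1)) / (2 * (q / 2 + 1)).factorial *
        Real.exp (M.segLength j r)) := by
  set x := M.segLength j r
  have hx : 0 ≤ x := M.segLength_nonneg j r
  have hc : 1 ≤ Real.exp (x ^ 2) := Real.one_le_exp (sq_nonneg x)
  have hA : ‖(x : ℂ) • M.generator j‖ ≤ x := by
    rw [norm_smul, Complex.norm_real, Real.norm_of_nonneg hx]
    exact mul_le_of_le_one_right hx (M.norm_generator_le j)
  have hS : ‖∑ a : M.SegIdx j q, (M.segCoeff j r q a : ℂ) • wordMat (M.segWord j r q a)‖ ≤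
      Real.exp (x ^ 2) := by
    refine (norm_sum_le _ _).trans (le_trans (le_of_eq ?_) (M.sum_segCoeff_le j r q))
    refine Finset.sum_congr rfl fun a _ => ?_
    have h0 : 0 ≤ M.segCoeff j r q a := by
      refine mul_nonneg (mul_nonneg (mul_nonneg (div_nonneg (pow_nonneg hx _) (Nat.cast_nonneg _))
        (Real.sqrt_nonneg _)) (Finset.prod_nonneg fun i _ => ?_)) ?_
      all_goals exact div_nonneg (M.h_pos j _).le (M.weight_pos j).le
    rw [norm_smul, norm_wordMat, Complex.norm_real, Real.norm_of_nonneg h0, mul_one]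
  rw [M.unitary_eq j hr, op_taylorLCU]
  refine (norm_pow_sub_pow_le hc ?_ hS r).trans ?_
  · rw [CStarRing.norm_of_mem_unitary (M.exp_mem_unitary j x)]
    exact hc
  · refine mul_le_mul_of_nonneg_left ?_ (by positivity)
    rw [sum_segment]
    exact norm_exp_sub_sum_le hA _

theorem length_word_taylorLCU_le (r q : ℕ) (a : (M.taylorLCU r q j).Idx) :
    ((M.taylorLCU r q j).word a).length ≤ r * (q + 1) := by
  change (List.ofFn fun s => M.segWord j r q (a s)).flatten.length ≤ _
  rw [List.length_flatten, List.map_ofFn, List.sum_ofFn]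
  refine (Finset.sum_le_card_nsmul _ _ (q + 1) fun s _ => ?_).trans (by simp)
  simp only [Function.comp_apply, segWord, List.length_append, List.length_ofFn, List.length_cons,
    List.length_nil]
  have := (a s).1.2
  omega

end Model


/-! ### The bias of the estimate -/

/-- The power is at most `exp (s / 3)`, and `exp u - 1 ≤ u + u²` at `u = s / 3` gives at most `4 s /
9`. -/
theorem one_add_pow_sub_one_le {K : ℕ} {s : ℝ} (hs : 0 ≤ s) (hs1 : s ≤ 1) :
    (1 + s / (6 * K)) ^ (2 * K) - 1 ≤ s / 2 := by
  have h1 : (1 + s / (6 * K)) ^ (2 * K) ≤ Real.exp (s / 3) := by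
    have h0 : 1 + s / (6 * K) ≤ Real.exp (s / (6 * K)) := by
      linarith [Real.add_one_le_exp (s / (6 * K))]
    calc _ ≤ Real.exp (s / (6 * K)) ^ (2 * K) := by gcongr
      _ = Real.exp ((2 * K : ℕ) * (s / (6 * K))) := (Real.exp_nat_mul _ _).symm
      _ ≤ _ := by
        rw [Real.exp_le_exp]
        rcases Nat.eq_zero_or_pos K with rfl | hK
        · simp; positivity
        · have : (0 : ℝ) < K := by exact_mod_cast hK
          refine le_of_eq ?_
          push_cast
          field_simp
          ring
  have h2 := (abs_le.1 (Real.abs_exp_sub_one_sub_id_le (x := s / 3)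
    (by rw [abs_of_nonneg (by positivity)]; linarith))).2
  nlinarith

section Bias

variable {n K : ℕ} (M : Model n K) {ρS : QOp (Fin n)} {ρE : ∀ j, QOp (Fin (M.e j))}
  {O : QOp (Fin n)}

theorem Model.norm_trace_collisionMap_le (hS : IsDensity ρS) (hE : ∀ j, IsDensity (ρE j)) :
    ‖(O * M.collisionMap ρE ρS).trace‖ ≤ ‖O‖ := by
  have := (crossMap_sub_crossMap hE le_rfl (fun j => (M.norm_unitary j).le)
    (W := M.unitary) (by simp) hS).1 O
  rwa [one_mul] at this

theorem Model.bias_le (hS : IsDensity ρS) (hE : ∀ j, IsDensity (ρE j)) {s : ℝ} (hs : 0 ≤ s)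
    (hs1 : s ≤ 1) {W : ∀ j, SEOp n (M.e j)} (hW : ∀ j, ‖M.unitary j - W j‖ ≤ s / (6 * K)) :
    ‖(O * crossMap ρE W W ρS).trace - (O * M.collisionMap ρE ρS).trace‖ ≤ s / 2 * ‖O‖ := by
  have h := (crossMap_sub_crossMap hE (by positivity) (fun j => (M.norm_unitary j).le) hW hS).2 O
  rw [mul_sub, Matrix.trace_sub] at h
  exact h.trans (mul_le_mul_of_nonneg_right (one_add_pow_sub_one_le hs hs1) (norm_nonneg O))

/-- An LCU of zero weight denotes `0`, which is at distance one from any unitary. -/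
theorem Model.weight_pos_of_norm_sub_lt {j : Fin K} {D : LCU n (M.e j)}
    (h : ‖M.unitary j - D.op‖ < 1) : 0 < D.weight := by
  refine lt_of_le_of_ne D.weight_nonneg fun h0 => ?_
  have hc := (Finset.sum_eq_zero_iff_of_nonneg fun k _ => D.coeff_nonneg k).1 h0.symm
  have hop : D.op = 0 := Finset.sum_eq_zero fun k hk => by rw [hc k hk]; simp
  rw [hop, sub_zero, M.norm_unitary] at h
  exact lt_irrefl _ h

theorem Model.succeeds_of_precision (hS : IsDensity ρS) (hE : ∀ j, IsDensity (ρE j))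
    (hO : O.IsHermitian) (hO0 : O ≠ 0) {ε δ : ℝ} (hε : 0 < ε) (hδ : 0 < δ) (hδ1 : δ < 1)
    (hεO : ε ≤ ‖O‖) (D : ∀ j, LCU n (M.e j))
    (hD : ∀ j, ‖M.unitary j - (D j).op‖ ≤ ε / (6 * K * ‖O‖)) {T : ℕ}
    (hT : 8 * ‖O‖ ^ 2 * Real.log (2 / δ) * zeta D ^ 4 / ε ^ 2 ≤ T) :
    Succeeds ρS ρE hO D T (O * M.collisionMap ρE ρS).trace ε δ := by
  have hn : 0 < ‖O‖ := norm_pos_iff.2 hO0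
  have hs1 : ε / ‖O‖ ≤ 1 := (div_le_one hn).2 hεO
  have hD' : ∀ j, ‖M.unitary j - (D j).op‖ ≤ ε / ‖O‖ / (6 * K) := fun j => by
    rw [div_div, mul_comm ‖O‖]; exact hD j
  have hw : ∀ j, 0 < (D j).weight := fun j => by
    refine M.weight_pos_of_norm_sub_lt ((hD' j).trans_lt ?_)
    have hK : (1 : ℝ) ≤ K := by exact_mod_cast j.pos
    rw [div_lt_one (by positivity)]
    linarith
  obtain ⟨m, hm, hl⟩ := boundedLaw_runLaw hS hE hO D fun j => (hw j).ne'
  refine succeeds_of_bias (Finset.prod_pos fun j _ => hw j) hn hl hε hδ hδ1 ?_ hT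
  rw [hm]
  refine (M.bias_le hS hE (by positivity) hs1 hD').trans (le_of_eq ?_)
  field_simp

end Bias

/-! ### The choice of the parameters -/

theorem log_le_two_fifths_mul {u : ℝ} (hu : 0 < u) : Real.log u ≤ 2 / 5 * u := by
  have h1 := Real.log_le_sub_one_of_pos (div_pos hu (Real.exp_pos 1))
  rw [Real.log_div hu.ne' (Real.exp_pos 1).ne', Real.log_exp] at h1
  have h2 : u / Real.exp 1 ≤ 2 / 5 * u := by
    rw [div_le_iff₀ (Real.exp_pos 1)]
    nlinarith [Real.exp_one_gt_d9]
  linarith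

theorem two_lt_log {y : ℝ} (hy : 16 ≤ y) : 2 < Real.log y ∧ 4 * Real.log 2 ≤ Real.log y := by
  have h1 : Real.log 16 ≤ Real.log y := Real.log_le_log (by norm_num) hy
  have h2 : Real.log 16 = 4 * Real.log 2 := by
    rw [show (16 : ℝ) = 2 ^ 4 by norm_num, Real.log_pow]; norm_num
  have := Real.log_two_gt_d9
  constructor <;> linarith

/-- From `N! ≥ (N / e) ^ N` it is enough that `N (log N - 1) ≥ log 480 + L` with `L = log y`. As
`log log L ≤ (2/5) log L` and `log 8 > 1`, `log N - 1 ≥ (3/5) log L`, so the left side is at least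
`(24/5) L`, while `log 480 ≤ 9 log 2 ≤ (9/4) L`. -/
theorem mul_le_factorial {y : ℝ} (hy : 16 ≤ y) {N : ℕ}
    (hN : 8 * (Real.log y / Real.log (Real.log y)) ≤ N) : 480 * y ≤ N.factorial := by
  obtain ⟨hL, hL2⟩ := two_lt_log hy
  set L := Real.log y
  have hlL : 0 < Real.log L := Real.log_pos (by linarith)
  have hN0 : (0 : ℝ) < N := lt_of_lt_of_le (by positivity) hN
  have h3 : Real.log 2 * 3 = Real.log 8 := by
    rw [show (8 : ℝ) = 2 ^ 3 by norm_num, Real.log_pow]; push_cast; ring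
  have hlog : 3 / 5 * Real.log L ≤ Real.log N - 1 := by
    have h1 := Real.log_le_log (by positivity) hN
    rw [Real.log_mul (by norm_num) (by positivity), Real.log_div (by positivity) hlL.ne'] at h1
    have h2 := log_le_two_fifths_mul hlL
    linarith [Real.log_two_gt_d9]
  have hmain : 9 / 4 * L + L ≤ N * (Real.log N - 1) := by
    calc _ ≤ 8 * (L / Real.log L) * (3 / 5 * Real.log L) := by
          have : 8 * (L / Real.log L) * (3 / 5 * Real.log L) = 24 / 5 * L := by field_simp; norm_num
          rw [this]; linarith
      _ ≤ _ := by gcongr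
  have h480 : Real.log 480 ≤ 9 / 4 * L := by
    have : Real.log 480 ≤ Real.log ((2 : ℝ) ^ 9) := Real.log_le_log (by norm_num) (by norm_num)
    rw [Real.log_pow] at this
    push_cast at this
    linarith
  have hf := Real.pow_div_factorial_le_exp (N : ℝ) hN0.le N
  have hfp : (0 : ℝ) < N.factorial := by exact_mod_cast N.factorial_pos
  rw [div_le_iff₀ hfp] at hf
  have hf' := Real.log_le_log (by positivity) hf
  rw [Real.log_pow, Real.log_mul (Real.exp_pos _).ne' hfp.ne', Real.log_exp] at hf'
  rw [← Real.log_le_log_iff (by positivity) hfp, Real.log_mul (by norm_num) (by positivity)]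
  change Real.log 480 + L ≤ _
  linarith

theorem one_le_log_div_log_log {y : ℝ} (hy : 16 ≤ y) :
    1 ≤ Real.log y / Real.log (Real.log y) := by
  have hL := (two_lt_log hy).1
  rw [one_le_div (Real.log_pos (by linarith))]
  linarith [log_le_two_fifths_mul (show 0 < Real.log y by linarith)]

theorem exp_one_sq_le : Real.exp 1 ^ 2 ≤ 15 / 2 := by
  have := Real.exp_one_lt_d9
  nlinarith [Real.exp_pos 1]

theorem log_two_div_le {δ : ℝ} (hδ : 0 < δ) :
    Real.log (2 / δ) ≤ 2 * Real.log (max 2 (1 / δ)) := by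
  rw [show 2 / δ = 2 * (1 / δ) by ring, Real.log_mul two_ne_zero (by positivity)]
  have h1 : Real.log 2 ≤ Real.log (max 2 (1 / δ)) :=
    Real.log_le_log two_pos (le_max_left _ _)
  have h2 : Real.log (1 / δ) ≤ Real.log (max 2 (1 / δ)) :=
    Real.log_le_log (by positivity) (le_max_right _ _)
  linarith

namespace Model

variable {n K : ℕ} (M : Model n K)

theorem weight_le_maxWeight (j : Fin K) : M.weight j ≤ M.maxWeight :=
  le_ciSup (Set.finite_range M.weight).bddAbove j

theorem mul_segLength_sq_le {r : ℕ} (hr : 1 ≤ r) (j : Fin K)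
    (hrK : M.maxWeight ^ 2 * M.Δt ^ 2 * K ≤ r) : r * M.segLength j r ^ 2 * K ≤ 1 := by
  have hr' : (0 : ℝ) < r := by exact_mod_cast hr
  have h1 : r * M.segLength j r ^ 2 * K = M.weight j ^ 2 * M.Δt ^ 2 * K / r := by
    rw [segLength]; field_simp
  rw [h1, div_le_one hr']
  refine le_trans ?_ hrK
  have := M.weight_le_maxWeight j
  have := (M.weight_pos j).le
  gcongr

theorem zeta_taylorLCU_pos (r q : ℕ) : 0 < zeta (M.taylorLCU r q) :=
  Finset.prod_pos fun j _ => M.weight_taylorLCU_pos j r q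

theorem zeta_taylorLCU_le {r : ℕ} (hr : 1 ≤ r) (q : ℕ)
    (hrK : M.maxWeight ^ 2 * M.Δt ^ 2 * K ≤ r) : zeta (M.taylorLCU r q) ≤ Real.exp 1 := by
  calc _ ≤ ∏ j, Real.exp (r * M.segLength j r ^ 2) :=
        Finset.prod_le_prod (fun j _ => (M.weight_taylorLCU_pos j r q).le) fun j _ => by
          rw [Real.exp_nat_mul]; exact M.weight_taylorLCU_le j r q
    _ = Real.exp (∑ j, r * M.segLength j r ^ 2) := (Real.exp_sum _ _).symm
    _ ≤ _ := by
      rw [Real.exp_le_exp]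
      calc _ ≤ ∑ _j : Fin K, (1 / K : ℝ) := Finset.sum_le_sum fun j _ => by
            have hK : (0 : ℝ) < K := by exact_mod_cast j.pos
            rw [le_div_iff₀ hK]
            exact M.mul_segLength_sq_le hr j hrK
        _ ≤ 1 := by
          rw [Finset.sum_const, Finset.card_univ, Fintype.card_fin, nsmul_eq_mul, mul_one_div]
          exact div_self_le_one _

/-- All the smallness is left to `N!`: `x ≤ 1` allows `x ^ N ≤ x`, the `r` segments add up to `r x =
β_j Δt`, and the exponentials contribute at most `e² ≤ 8`. -/
theorem norm_unitary_sub_taylorLCU_le_factorial {r : ℕ} (hr : 1 ≤ r) (q : ℕ) (j : Fin K)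
    (hrK : M.maxWeight ^ 2 * M.Δt ^ 2 * K ≤ r) :
    ‖M.unitary j - (M.taylorLCU r q j).op‖ ≤
      8 * (M.maxWeight * M.Δt) / (2 * (q / 2 + 1)).factorial := by
  refine (M.norm_unitary_sub_taylorLCU_le j hr q).trans ?_
  have hr' : (1 : ℝ) ≤ r := by exact_mod_cast hr
  have hK : (1 : ℝ) ≤ K := by exact_mod_cast j.pos
  have hrx : r * M.segLength j r = M.weight j * M.Δt := by
    rw [segLength]; field_simp
  have hw := M.weight_le_maxWeight j
  have hx := M.segLength_nonneg j r
  have h0 := M.mul_segLength_sq_le hr j hrK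
  set x := M.segLength j r
  set N := 2 * (q / 2 + 1)
  have h1 : r * x ^ 2 ≤ 1 := le_trans (le_mul_of_one_le_right (by positivity) hK) h0
  have hx1 : x ≤ 1 := by nlinarith
  have hxN : x ^ N ≤ x := by
    have := pow_le_pow_of_le_one hx hx1 (show 1 ≤ N by omega)
    rwa [pow_one] at this
  have hΔ := M.Δt_pos
  have hm : 0 ≤ M.maxWeight := (M.weight_pos j).le.trans hw
  calc r * Real.exp (x ^ 2) ^ r * (x ^ N / N.factorial * Real.exp x)
      = Real.exp (r * x ^ 2) * Real.exp x * (r * x ^ N) / N.factorial := by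
        rw [Real.exp_nat_mul]; ring
    _ ≤ Real.exp 1 * Real.exp 1 * (r * x) / N.factorial := by gcongr
    _ = Real.exp 1 ^ 2 * (M.weight j * M.Δt) / N.factorial := by rw [hrx]; ring
    _ ≤ 8 * (M.maxWeight * M.Δt) / N.factorial := by
        have he : Real.exp 1 ^ 2 ≤ 8 := by linarith [exp_one_sq_le]
        have hb : 0 ≤ M.weight j * M.Δt := mul_nonneg (M.weight_pos j).le hΔ.le
        gcongr

theorem runDepth_taylorLCU_le (V : ∀ j, PrepCircuit (M.e j)) (r q : ℕ)
    (a b : ∀ j, (M.taylorLCU r q j).Idx) :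
    runDepth V (fun j => (M.taylorLCU r q j).word (a j))
      (fun j => (M.taylorLCU r q j).word (b j)) ≤
      K * (2 * (r * (q + 1))) + K * Finset.univ.sup fun j => (V j).depth := by
  unfold runDepth
  refine (Finset.sum_le_card_nsmul _ _
    (2 * (r * (q + 1)) + Finset.univ.sup fun j => (V j).depth) fun j _ => ?_).trans ?_
  · have h1 : (V j).depth ≤ Finset.univ.sup fun j => (V j).depth :=
      Finset.le_sup (f := fun j => (V j).depth) (Finset.mem_univ j)
    have h2 := M.length_word_taylorLCU_le j r q (a j)
    have h3 := M.length_word_taylorLCU_le j r q (b j)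
    simp only [collisionGates, List.length_append, List.length_map]
    omega
  · simp [mul_add]

end Model

end Collision

end

/-! ### The main theorem: choice of `r`, `q`, `T` and of the constant. -/

theorem mainTheorem1 :
    ∃ C : ℝ, 0 < C ∧
      ∀ (n K : ℕ) (M : Collision.Model n K)
        (ρS : Collision.QOp (Fin n)) (_hρS : Collision.IsDensity ρS)
        (ρE : ∀ j, Collision.QOp (Fin (M.e j)))
        (V : ∀ j, Collision.PrepCircuit (M.e j)) (_hV : ∀ j, (V j).state = ρE j)
        (O : Collision.QOp (Fin n)) (hO : O.IsHermitian) (_hO0 : O ≠ 0)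
        (ε δ : ℝ) (_hε0 : 0 < ε) (_hε1 : ε < 1) (_hδ0 : 0 < δ) (_hδ1 : δ < 1),
        -- correctness for all input LCUs of precision `ε / (6 K ‖O‖)`
        (ε ≤ ‖O‖ →
          ∀ (D : ∀ j, Collision.LCU n (M.e j)),
            (∀ j, ‖M.unitary j - (D j).op‖ ≤ ε / (6 * K * ‖O‖)) →
            ∀ T : ℕ,
              8 * ‖O‖ ^ 2 * Real.log (2 / δ) * Collision.zeta D ^ 4 / ε ^ 2 ≤ T →
              Collision.Succeeds ρS ρE hO D T (O * M.collisionMap ρE ρS).trace ε δ) ∧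
        -- correctness and cost with the truncated Taylor series LCUs
        (∃ r q T : ℕ,
          1 ≤ r ∧
          (r : ℝ) ≤ C * max 1 (M.maxWeight ^ 2 * M.Δt ^ 2 * K) ∧
          (∀ j, ‖M.unitary j - (M.taylorLCU r q j).op‖ ≤ ε / (6 * K * ‖O‖)) ∧
          Collision.zeta (M.taylorLCU r q) ≤ C ∧
          (T : ℝ) ≤ C * max 1 (‖O‖ ^ 2 * Real.log (max 2 (1 / δ)) / ε ^ 2) ∧
          Collision.Succeeds ρS ρE hO (M.taylorLCU r q) T
            (O * M.collisionMap ρE ρS).trace ε δ ∧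
          ∀ a b : ∀ j, (M.taylorLCU r q j).Idx,
            (Collision.runDepth V (fun j => (M.taylorLCU r q j).word (a j))
                (fun j => (M.taylorLCU r q j).word (b j)) : ℝ) ≤
              C * (K * max 1 (M.maxWeight ^ 2 * M.Δt ^ 2 * K)
                    * (Real.log (max 16 (M.maxWeight * K * ‖O‖ * M.Δt / ε))
                        / Real.log (Real.log (max 16 (M.maxWeight * K * ‖O‖ * M.Δt / ε))))
                  + K * (Finset.univ.sup fun j => (V j).depth : ℕ))) := by
  -- The largest demand comes from `T ≤ 900 R + 1`; the depth only needs `2 * 2 * 10 = 40`.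
  refine ⟨1000, by norm_num, ?_⟩
  intro n K M ρS hS ρE V hV O hO hO0 ε δ hε _ hδ hδ1
  have hE : ∀ j, Collision.IsDensity (ρE j) := fun j => hV j ▸ (V j).isDensity_state
  refine ⟨fun hεO D hD T hT =>
    M.succeeds_of_precision hS hE hO hO0 hε hδ hδ1 hεO D hD hT, ?_⟩
  have hn : 0 < ‖O‖ := norm_pos_iff.2 hO0
  set a : ℝ := M.maxWeight ^ 2 * M.Δt ^ 2 * K
  have ha : 0 ≤ a := by positivity
  set y : ℝ := max 16 (M.maxWeight * K * ‖O‖ * M.Δt / ε)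
  have hy : 16 ≤ y := le_max_left _ _
  set f : ℝ := Real.log y / Real.log (Real.log y)
  have hf : 1 ≤ f := Collision.one_le_log_div_log_log hy
  set R : ℝ := ‖O‖ ^ 2 * Real.log (max 2 (1 / δ)) / ε ^ 2
  set r : ℕ := max 1 ⌈a⌉₊
  set q : ℕ := ⌈8 * f⌉₊
  have hr : 1 ≤ r := le_max_left _ _
  have har : a ≤ r := (Nat.le_ceil a).trans (by exact_mod_cast le_max_right 1 ⌈a⌉₊)
  have hr2 : (r : ℝ) ≤ 2 * max 1 a := by
    rw [Nat.cast_max, Nat.cast_one]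
    refine max_le (by linarith [le_max_left 1 a]) ?_
    linarith [Nat.ceil_lt_add_one ha, le_max_left 1 a, le_max_right 1 a]
  have hq : (q : ℝ) + 1 ≤ 10 * f := by
    linarith [Nat.ceil_lt_add_one (show 0 ≤ 8 * f by linarith)]
  have hζ0 := M.zeta_taylorLCU_pos r q
  have hζ := M.zeta_taylorLCU_le hr q har
  set ζ := Collision.zeta (M.taylorLCU r q)
  have hζ2 : ζ ^ 2 ≤ 15 / 2 := (pow_le_pow_left₀ hζ0.le hζ 2).trans Collision.exp_one_sq_le
  -- Ten times the required precision, so that the bias bound, which needs its parameter at most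
  -- one, is available for all `ε ≤ 10 * ‖O‖`. The `480` in `mul_le_factorial` is `8 * 10 * 6`.
  have hprec : ∀ j, ‖M.unitary j - (M.taylorLCU r q j).op‖ ≤ ε / (10 * ‖O‖) / (6 * K) := by
    intro j
    refine (M.norm_unitary_sub_taylorLCU_le_factorial hr q j har).trans ?_
    have hK : (0 : ℝ) < K := by exact_mod_cast j.pos
    have hfac : 480 * y ≤ ((2 * (q / 2 + 1)).factorial : ℝ) := by
      refine Collision.mul_le_factorial hy ((Nat.le_ceil _).trans ?_)
      exact_mod_cast (by omega : q ≤ 2 * (q / 2 + 1))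
    have hy' : M.maxWeight * K * ‖O‖ * M.Δt / ε ≤ y := le_max_right _ _
    rw [div_le_iff₀ hε] at hy'
    rw [div_div, div_le_div_iff₀ (by positivity) (by positivity)]
    nlinarith
  have hprec' : ∀ j, ‖M.unitary j - (M.taylorLCU r q j).op‖ ≤ ε / (6 * K * ‖O‖) := by
    intro j
    have hK : (0 : ℝ) < K := by exact_mod_cast j.pos
    refine (hprec j).trans ?_
    rw [div_div]
    refine div_le_div_of_nonneg_left hε.le (by positivity) ?_
    have : 0 < K * ‖O‖ := by positivity
    linarith
  set T : ℕ := ⌈8 * ‖O‖ ^ 2 * Real.log (2 / δ) * ζ ^ 4 / ε ^ 2⌉₊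
  have hlog : 0 < Real.log (2 / δ) := Real.log_pos (by rw [lt_div_iff₀ hδ]; linarith)
  refine ⟨r, q, T, hr, ?_, hprec', ?_, ?_, ?_, ?_⟩
  · linarith [le_max_left 1 a]
  · linarith [Real.exp_one_lt_d9]
  · have h1 : 8 * ‖O‖ ^ 2 * Real.log (2 / δ) * ζ ^ 4 / ε ^ 2 ≤ 900 * R := by
      have h4 : ζ ^ 4 ≤ 225 / 4 := by nlinarith
      have h2 := Collision.log_two_div_le hδ
      have h3 : 0 ≤ Real.log (max 2 (1 / δ)) := by linarith
      calc _ ≤ 8 * ‖O‖ ^ 2 * (2 * Real.log (max 2 (1 / δ))) * (225 / 4) / ε ^ 2 := by gcongr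
        _ = 900 * R := by simp only [R]; ring
    have h3 : (T : ℝ) < 8 * ‖O‖ ^ 2 * Real.log (2 / δ) * ζ ^ 4 / ε ^ 2 + 1 :=
      Nat.ceil_lt_add_one (by positivity)
    linarith [le_max_left 1 R, le_max_right 1 R]
  · obtain ⟨m, hm, hl⟩ := Collision.boundedLaw_runLaw hS hE hO (M.taylorLCU r q)
      fun j => (M.weight_taylorLCU_pos j r q).ne'
    -- Beyond `10 * ‖O‖` the error is trivially small enough, since `ζ ^ 2 + 1 ≤ 17 / 2 < 10`.
    rcases le_or_gt ε (10 * ‖O‖) with h10 | h10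
    · refine Collision.succeeds_of_bias hζ0 hn hl hε hδ hδ1 ?_ (Nat.le_ceil _)
      rw [hm]
      refine (M.bias_le hS hE (by positivity) ((div_le_one (by positivity)).2 h10) hprec).trans ?_
      have : ε / (10 * ‖O‖) / 2 * ‖O‖ = ε / 20 := by field_simp; norm_num
      linarith
    · refine Collision.succeeds_of_bound hl hδ ?_ T
      have h1 := M.norm_trace_collisionMap_le (O := O) hS hE
      have h2 : ζ ^ 2 * ‖O‖ ≤ 15 / 2 * ‖O‖ := by gcongr
      linarith
  · intro x z
    have h1 : (Collision.runDepth V (fun j => (M.taylorLCU r q j).word (x j))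
        (fun j => (M.taylorLCU r q j).word (z j)) : ℝ) ≤
        K * (2 * (r * (q + 1))) + K * (Finset.univ.sup fun j => (V j).depth : ℕ) := by
      exact_mod_cast M.runDepth_taylorLCU_le V r q x z
    have h2 : (r : ℝ) * (q + 1) ≤ 2 * max 1 a * (10 * f) := by gcongr
    have h3 : (K : ℝ) * (2 * (r * (q + 1))) ≤ K * (2 * (2 * max 1 a * (10 * f))) := by gcongr
    have h4 : 0 ≤ K * max 1 a * f := by positivity
    have h5 : (0 : ℝ) ≤ K * (Finset.univ.sup fun j => (V j).depth : ℕ) := by positivity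
    rw [mul_add]
    linarith
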